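/- Let $\mathfrak g=\mathfrak{sl}(\infty)=\bigcup_n\mathfrak g_n$, $\mathfrak g_n=\mathfrak{sl}(n+1)$, be the complex Lie algebra of traceless $\mathbb Z_{>0}\times\mathbb Z_{>0}$ matrices with finitely many nonzero entries, $\mathfrak h$ its diagonal Cartan subalgebra, and $\mathfrak g_{\varepsilon_i-\varepsilon_j}=\mathbb C E_{ij}$ ($i\neq j$) its root spaces. Let $\prec$ be a (strict) partial order on $\mathbb Z_{>0}$ that is admissible: with $[i]=\{i\}\cup\{j : i,j \text{ not comparable}\}$, $[i]\ne[j]$ implies $[i]\cap[j]=\emptyset$. Let $\mathfrak p(\prec)=\mathfrak l(\prec)\oplus\mathfrak u(\prec)$ be the parabolic subalgebra whose reductive component $\mathfrak l(\prec)$ is generated by $\mathfrak h$ and the $E_{ij}$ with $i\neq j$ not comparable, and whose locally nilpotent radical $\mathfrak u(\prec)$ is generated by the $E_{ij}$ with $i\prec j$. Let $\mu=(\mu_1\ge\dots\ge\mu_k>0)$, $k\ge 1$, be a partition, and let $S^\mu V=\varinjlim_n L_n(\mu)$, where $L_n(\mu)$ is the simple $\mathfrak g_n$-module with highest weight $\mu$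 relative to the upper triangular Borel subalgebra of $\mathfrak g_n$, and the embeddings $L_n(\mu)\hookrightarrow L_{n+1}(\mu)$ of $\mathfrak g_n$-modules, $n\gg 0$, map highest weight vectors to highest weight vectors. All weight modules (relative to $\mathfrak h$) are assumed to have finite-dimensional weight spaces. A simple weight $\mathfrak g$-module $M$ is called $\mathfrak p(\prec)$-aligned if there is a simple weight $\mathfrak l(\prec)$-module $S$ such that, letting $\mathfrak u(\prec)$ act on $S$ by zero, $M$ is isomorphic to the unique simple quotient of $U(\mathfrak g)\otimes_{U(\mathfrak p(\prec))}S$. Then $S^\mu V$ is $\mathfrak p(\prec)$-aligned if and only if there are pairwise distinct $i_1,\dots,i_k\in\mathbb Z_{>0}$, ordered so that $i_a\prec i_b$ implies $a<b$, such that every $m\in\mathbb Z_{>0}\setminus\{i_1,\dots,i_k\}$ satisfies $i_k\prec m$, or $m$ is not comparable with $i_j$ for some $j\in\{1,\dots,k\}$. -/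

import Mathlib

open scoped TensorProduct

/-! ## Weight modules and aligned modules over a complex Lie algebra -/

section Aligned

universe u v

variable {L : Type v} [LieRing L] [LieAlgebra ℂ L]

/-- The weight space `M_ν = {m | h m = ν(h) m for all h ∈ H}`. -/
def wtSpace (H : LieSubalgebra ℂ L) (M : Type u) [AddCommGroup M] [Module ℂ M]
    [LieRingModule L M] [LieModule ℂ L M] (ν : Module.Dual ℂ H) : Submodule ℂ M where
  carrier := {m | ∀ h : H, ⁅(h : L), m⁆ = ν h • m}
  add_mem' := by
    intro a b ha hb h
    rw [lie_add, ha h, hb h, smul_add]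
  zero_mem' := by intro h; simp
  smul_mem' := by
    intro c a ha h
    rw [lie_smul, ha h, smul_comm]

/-- `M` is a weight module with finite-dimensional weight spaces: it is the sum of its weight
spaces (the sum is then automatically direct), and they are all finite-dimensional. -/
def IsWeightModule (H : LieSubalgebra ℂ L) (M : Type u) [AddCommGroup M] [Module ℂ M]
    [LieRingModule L M] [LieModule ℂ L M] : Prop :=
  (⨆ ν : Module.Dual ℂ H, wtSpace H M ν) = ⊤ ∧
    ∀ ν : Module.Dual ℂ H, FiniteDimensional ℂ (wtSpace H M ν)

/-- The left `U(L)`-submodule of `U(L) ⊗_ℂ S` generated by all `a x ⊗ s - a ⊗ x s` with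
`a ∈ U(L)`, `x ∈ p`, `s ∈ S`. As `p` generates the algebra `U(p)`, the quotient by it is
`U(L) ⊗_{U(p)} S`. -/
def inducedRel (p : LieSubalgebra ℂ L) (S : Type u) [AddCommGroup S] [Module ℂ S]
    [LieRingModule p S] [LieModule ℂ p S] :
    Submodule (UniversalEnvelopingAlgebra ℂ L) (UniversalEnvelopingAlgebra ℂ L ⊗[ℂ] S) :=
  Submodule.span _ {t | ∃ (a : UniversalEnvelopingAlgebra ℂ L) (x : p) (s : S),
    t = (a * UniversalEnvelopingAlgebra.ι ℂ (x : L)) ⊗ₜ[ℂ] s - a ⊗ₜ[ℂ] ⁅x, s⁆}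

/-- The induced module `M_p(S) = U(L) ⊗_{U(p)} S`. -/
abbrev InducedModule (p : LieSubalgebra ℂ L) (S : Type u) [AddCommGroup S] [Module ℂ S]
    [LieRingModule p S] [LieModule ℂ p S] : Type _ :=
  (UniversalEnvelopingAlgebra ℂ L ⊗[ℂ] S) ⧸ inducedRel p S

/-- Let `p = l ⊕ n` be a parabolic subalgebra of `L` containing the Cartan subalgebra `H`, with
reductive component `l` and nilradical `n`. The `L`-module `M` is `p`-aligned if it is a simple
weight module and there is a simple weight `l`-module `S`, made into a `p`-module by `n S = 0`,
such that `M` is isomorphic to the unique simple quotient of `M_p(S)`. (An `l`-module on which `n`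
is made to act by zero is the same as a `p`-module on which `n` acts by zero; submodules of
`M_p(S)` are its `U(L)`-submodules.) -/
def IsAligned (H p l n : LieSubalgebra ℂ L) (M : Type u) [AddCommGroup M] [Module ℂ M]
    [LieRingModule L M] [LieModule ℂ L M] : Prop :=
  LieModule.IsIrreducible ℂ L M ∧ IsWeightModule H M ∧
  ∃ (S : Type u) (_ : AddCommGroup S) (_ : Module ℂ S) (_ : LieRingModule p S)
    (_ : LieModule ℂ p S),
    LieModule.IsIrreducible ℂ (l.comap p.incl) S ∧
    IsWeightModule (H.comap p.incl) S ∧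
    (∀ x : p, (x : L) ∈ n → ∀ s : S, ⁅x, s⁆ = 0) ∧
    ∃ N : Submodule (UniversalEnvelopingAlgebra ℂ L) (InducedModule p S),
      IsCoatom N ∧ (∀ N', IsCoatom N' → N' = N) ∧
      ∃ φ : (InducedModule p S ⧸ N) ≃ₗ[ℂ] M,
        ∀ (x : L) (q : InducedModule p S ⧸ N),
          φ (UniversalEnvelopingAlgebra.ι ℂ x • q) = ⁅x, φ q⁆

end Aligned

/-! ## The Lie algebra `𝔰𝔩(∞)` and its subalgebras -/

/-- The natural representation `V`, with basis `e_i = Finsupp.single i 1`, `i ∈ ℤ_{>0}`. -/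
abbrev NatRep : Type := ℕ+ →₀ ℂ

noncomputable instance : LieRing (Module.End ℂ NatRep) := LieRing.ofAssociativeRing

/-- `End V` acts on itself by the commutator (adjoint action). -/
noncomputable instance (priority := 2000) :
    LieRingModule (Module.End ℂ NatRep) (Module.End ℂ NatRep) := lieRingSelfModule

theorem endNat_lie (x y : Module.End ℂ NatRep) : ⁅x, y⁆ = x * y - y * x := rfl

/-- The matrix unit `E_{ij}`, sending `e_j` to `e_i` and all other `e_l` to `0`. For `i ≠ j` it
spans the root space of the root `ε_i - ε_j`. -/
noncomputable def matUnit (i j : ℕ+) : Module.End ℂ NatRep :=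
  Finsupp.lsingle i ∘ₗ Finsupp.lapply j

theorem matUnit_single (i j l : ℕ+) (c : ℂ) :
    matUnit i j (Finsupp.single l c) = if l = j then Finsupp.single i c else 0 := by
  by_cases h : l = j
  · subst h; simp [matUnit]
  · simp [matUnit, h]

theorem matUnit_mul (i j p q : ℕ+) :
    matUnit i j * matUnit p q = if p = j then matUnit i q else 0 := by
  refine Finsupp.lhom_ext fun l c => ?_
  rw [Module.End.mul_apply, matUnit_single]
  by_cases h : l = q <;> by_cases h' : p = j <;> simp [h, h', matUnit_single]

theorem matUnit_lie (i j p q : ℕ+) :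
    ⁅matUnit i j, matUnit p q⁆ =
      (if p = j then matUnit i q else 0) - (if i = q then matUnit p j else 0) := by
  rw [endNat_lie, matUnit_mul, matUnit_mul]

/-- Generators of the Lie algebra of traceless finitary matrices with rows and columns in `s`. -/
def slGen (s : Set ℕ+) : Set (Module.End ℂ NatRep) :=
  {x | ∃ i ∈ s, ∃ j ∈ s, i ≠ j ∧ (x = matUnit i j ∨ x = matUnit i i - matUnit j j)}

theorem matUnit_lie_mem (s : Set ℕ+) {i j p q : ℕ+} (hi : i ∈ s) (hj : j ∈ s) (hp : p ∈ s)
    (hq : q ∈ s) : ⁅matUnit i j, matUnit p q⁆ ∈ Submodule.span ℂ (slGen s) := by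
  have hE : ∀ a ∈ s, ∀ b ∈ s, a ≠ b → matUnit a b ∈ Submodule.span ℂ (slGen s) :=
    fun a ha b hb hab => Submodule.subset_span ⟨a, ha, b, hb, hab, Or.inl rfl⟩
  have hH : ∀ a ∈ s, ∀ b ∈ s, matUnit a a - matUnit b b ∈ Submodule.span ℂ (slGen s) := by
    intro a ha b hb
    by_cases hab : a = b
    · simp [hab]
    · exact Submodule.subset_span ⟨a, ha, b, hb, hab, Or.inr rfl⟩
  rw [matUnit_lie]
  by_cases h1 : p = j <;> by_cases h2 : i = q
  · subst h1 h2; simpa using hH _ hi _ hj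
  · simpa [h1, h2] using hE _ hi _ hq h2
  · simpa [h1, h2] using hE _ hp _ hj h1
  · simp [h1, h2]

/-- The Lie algebra `𝔰𝔩(s)` of traceless matrices with finitely many nonzero entries, all of them
in rows and columns indexed by `s`: it is spanned by the `E_{ij}` and the `E_{ii} - E_{jj}` with
`i ≠ j` in `s`. -/
noncomputable def slOn (s : Set ℕ+) : LieSubalgebra ℂ (Module.End ℂ NatRep) where
  __ := Submodule.span ℂ (slGen s)
  lie_mem' := by
    intro x y hx hy
    change x ∈ Submodule.span ℂ (slGen s) at hx
    change y ∈ Submodule.span ℂ (slGen s) at hy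
    change ⁅x, y⁆ ∈ Submodule.span ℂ (slGen s)
    induction hx using Submodule.span_induction with
    | zero => simp
    | add a b _ _ ha hb => rw [add_lie]; exact Submodule.add_mem _ ha hb
    | smul c a _ ha => rw [smul_lie]; exact Submodule.smul_mem _ _ ha
    | mem x hx =>
      induction hy using Submodule.span_induction with
      | zero => simp
      | add a b _ _ ha hb => rw [lie_add]; exact Submodule.add_mem _ ha hb
      | smul c a _ ha => rw [lie_smul]; exact Submodule.smul_mem _ _ ha
      | mem y hy =>
        obtain ⟨i, hi, j, hj, -, rfl | rfl⟩ := hx <;> obtain ⟨p, hp, q, hq, -, rfl | rfl⟩ := hy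
        · exact matUnit_lie_mem s hi hj hp hq
        · rw [lie_sub]
          exact Submodule.sub_mem _ (matUnit_lie_mem s hi hj hp hp) (matUnit_lie_mem s hi hj hq hq)
        · rw [sub_lie]
          exact Submodule.sub_mem _ (matUnit_lie_mem s hi hi hp hq) (matUnit_lie_mem s hj hj hp hq)
        · rw [sub_lie, lie_sub, lie_sub]
          exact Submodule.sub_mem _
            (Submodule.sub_mem _ (matUnit_lie_mem s hi hi hp hp) (matUnit_lie_mem s hi hi hq hq))
            (Submodule.sub_mem _ (matUnit_lie_mem s hj hj hp hp) (matUnit_lie_mem s hj hj hq hq))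

theorem mem_slOn {s : Set ℕ+} {x : Module.End ℂ NatRep} :
    x ∈ slOn s ↔ x ∈ Submodule.span ℂ (slGen s) := Iff.rfl

/-- The Lie algebra `𝔤 = 𝔰𝔩(∞)`. -/
noncomputable abbrev slInf : LieSubalgebra ℂ (Module.End ℂ NatRep) := slOn Set.univ

/-- The Lie algebra `𝔤_n = 𝔰𝔩(n+1)`, acting on the span of `e_1, …, e_{n+1}`. -/
noncomputable abbrev slFin (n : ℕ) : LieSubalgebra ℂ (Module.End ℂ NatRep) :=
  slOn {i | (i : ℕ) ≤ n + 1}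

/-- The Cartan subalgebra of diagonal matrices in `𝔰𝔩(∞)`. -/
noncomputable def slCartan : LieSubalgebra ℂ slInf :=
  LieSubalgebra.lieSpan ℂ slInf {x | ∃ i j : ℕ+, (x : Module.End ℂ NatRep) =
    matUnit i i - matUnit j j}

/-- `i` and `j` are not comparable with respect to the strict partial order `r`
(in particular `i` is not comparable with itself in this sense). -/
def Incomp (r : ℕ+ → ℕ+ → Prop) (i j : ℕ+) : Prop := ¬ r i j ∧ ¬ r j i

/-- The set `[i] = {i} ∪ {j | i and j are not comparable}`. -/
def orderClass (r : ℕ+ → ℕ+ → Prop) (i : ℕ+) : Set ℕ+ := {i} ∪ {j | Incomp r i j}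

/-- A partial order is admissible if `[i] ≠ [j]` implies `[i] ∩ [j] = ∅`. -/
def IsAdmissible (r : ℕ+ → ℕ+ → Prop) : Prop :=
  ∀ i j, orderClass r i ≠ orderClass r j → orderClass r i ∩ orderClass r j = ∅

/-- The parabolic subalgebra `𝔭(≺)`: it is generated by the Cartan subalgebra and the root spaces
of the roots `ε_i - ε_j ∈ P(≺)`, that is, of those with `i ≺ j` or with `i`, `j` incomparable. -/
noncomputable def parabolic (r : ℕ+ → ℕ+ → Prop) : LieSubalgebra ℂ slInf :=
  LieSubalgebra.lieSpan ℂ slInf ((slCartan : Set slInf) ∪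
    {x | ∃ i j : ℕ+, i ≠ j ∧ (r i j ∨ Incomp r i j) ∧ (x : Module.End ℂ NatRep) = matUnit i j})

/-- The reductive component `𝔩(≺)` of `𝔭(≺)`: it is generated by the Cartan subalgebra and the root
spaces of the roots `ε_i - ε_j ∈ P(≺)⁰`, that is, of those with `i`, `j` incomparable. -/
noncomputable def levi (r : ℕ+ → ℕ+ → Prop) : LieSubalgebra ℂ slInf :=
  LieSubalgebra.lieSpan ℂ slInf ((slCartan : Set slInf) ∪
    {x | ∃ i j : ℕ+, i ≠ j ∧ Incomp r i j ∧ (x : Module.End ℂ NatRep) = matUnit i j})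

/-- The locally nilpotent radical `𝔲(≺)` of `𝔭(≺)`: it is generated by the root spaces of the roots
`ε_i - ε_j ∈ P(≺)⁺`, that is, of those with `i ≺ j`. -/
noncomputable def nilrad (r : ℕ+ → ℕ+ → Prop) : LieSubalgebra ℂ slInf :=
  LieSubalgebra.lieSpan ℂ slInf
    {x | ∃ i j : ℕ+, r i j ∧ (x : Module.End ℂ NatRep) = matUnit i j}

theorem levi_le_parabolic (r : ℕ+ → ℕ+ → Prop) : levi r ≤ parabolic r := by
  refine LieSubalgebra.lieSpan_mono (Set.union_subset_union_right _ ?_)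
  rintro x ⟨i, j, h, h', hx⟩
  exact ⟨i, j, h, Or.inr h', hx⟩

theorem nilrad_le_parabolic (r : ℕ+ → ℕ+ → Prop) [IsStrictOrder ℕ+ r] :
    nilrad r ≤ parabolic r := by
  refine LieSubalgebra.lieSpan_mono (Set.subset_union_of_subset_right ?_ _)
  rintro x ⟨i, j, h, hx⟩
  exact ⟨i, j, ne_of_irrefl h, Or.inl h, hx⟩

/-! ## The modules `S^μ V`

All stages of the direct limit are realized inside the algebra `Sym(V ⊗ ℂ^k)`, the polynomial ring
in the variables `x_{a,j} = e_a ⊗ f_j`, on which `𝔤𝔩(V)` acts by derivations through `V`. -/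

/-- The polynomial algebra `Sym(V ⊗ ℂ^k)`. -/
abbrev PolyRep (k : ℕ) : Type := MvPolynomial (ℕ+ × Fin k) ℂ

/-- The embedding `V → Sym(V ⊗ ℂ^k)`, `w ↦ w ⊗ f_j`. -/
noncomputable def colEmb (k : ℕ) (j : Fin k) : NatRep →ₗ[ℂ] PolyRep k :=
  Finsupp.linearCombination ℂ fun a => (MvPolynomial.X (a, j) : PolyRep k)

/-- The derivation of `Sym(V ⊗ ℂ^k)` extending `w ⊗ f ↦ (x w) ⊗ f`. -/
noncomputable def symDer (k : ℕ) (x : Module.End ℂ NatRep) :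
    Derivation ℂ (PolyRep k) (PolyRep k) :=
  MvPolynomial.mkDerivation ℂ fun q => colEmb k q.2 (x (Finsupp.single q.1 1))

theorem symDer_X (k : ℕ) (x : Module.End ℂ NatRep) (q : ℕ+ × Fin k) :
    symDer k x (MvPolynomial.X q) = colEmb k q.2 (x (Finsupp.single q.1 1)) :=
  MvPolynomial.mkDerivation_X _ _ _

theorem symDer_colEmb (k : ℕ) (x : Module.End ℂ NatRep) (j : Fin k) (w : NatRep) :
    symDer k x (colEmb k j w) = colEmb k j (x w) := by
  have : (symDer k x).toLinearMap ∘ₗ colEmb k j = colEmb k j ∘ₗ x := by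
    refine Finsupp.lhom_ext' fun a => LinearMap.ext_ring ?_
    simp [colEmb, symDer_X]
  exact LinearMap.congr_fun this w

/-- The action of `𝔤𝔩(V)` on `Sym(V ⊗ ℂ^k)`. -/
noncomputable def symAct (k : ℕ) :
    Module.End ℂ NatRep →ₗ⁅ℂ⁆ Derivation ℂ (PolyRep k) (PolyRep k) where
  toFun := symDer k
  map_add' x y := MvPolynomial.derivation_ext fun q => by simp [symDer_X]
  map_smul' c x := MvPolynomial.derivation_ext fun q => by simp [symDer_X]
  map_lie' := by
    intro x y
    refine MvPolynomial.derivation_ext fun q => ?_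
    rw [Derivation.commutator_apply, symDer_X, symDer_X, symDer_X, symDer_colEmb, symDer_colEmb,
      endNat_lie]
    simp

noncomputable instance (k : ℕ) : LieRingModule (Module.End ℂ NatRep) (PolyRep k) :=
  LieRingModule.compLieHom (PolyRep k) (symAct k)

instance (k : ℕ) : LieModule ℂ (Module.End ℂ NatRep) (PolyRep k) :=
  LieModule.compLieHom (PolyRep k) (symAct k)

theorem lie_sym_apply (k : ℕ) (x : Module.End ℂ NatRep) (p : PolyRep k) :
    ⁅x, p⁆ = symDer k x p := rfl

/-- The leading minor `Δ_m = det (x_{a,j})_{1 ≤ a, j ≤ m}`, of weight `ε_1 + ⋯ + ε_m`. -/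
noncomputable def leadMinor (k m : ℕ) (hm : m ≤ k) : PolyRep k :=
  Matrix.det (Matrix.of fun a j : Fin m =>
    (MvPolynomial.X ((a : ℕ).succPNat, Fin.castLE hm j) : PolyRep k))

/-- The part `μ_{j+1}` of `μ = (μ_1, …, μ_k)`, with `μ_i = 0` for `i > k`. -/
def partAt {k : ℕ} (μ : Fin k → ℕ) (j : ℕ) : ℕ := if h : j < k then μ ⟨j, h⟩ else 0

/-- The vector `Δ_1^{μ_1 - μ_2} Δ_2^{μ_2 - μ_3} ⋯ Δ_k^{μ_k}`, a highest weight vector of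
weight `μ_1 ε_1 + ⋯ + μ_k ε_k`. -/
noncomputable def hwVec {k : ℕ} (μ : Fin k → ℕ) : PolyRep k :=
  ∏ j : Fin k, leadMinor k (j + 1) j.isLt ^ (μ j - partAt μ (j + 1))

/-- The simple highest weight `𝔤_n`-module `L(μ)`: the `𝔤_n`-submodule generated by the highest
weight vector. -/
noncomputable def schurStage {k : ℕ} (μ : Fin k → ℕ) (n : ℕ) :
    LieSubmodule ℂ (slFin n) (PolyRep k) :=
  LieSubmodule.lieSpan ℂ (slFin n) {hwVec μ}

/-! ### The stages are simple highest weight modules, and form an ascending chain -/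

theorem derivation_sum_apply {ι A : Type*} [CommRing A] [Algebra ℂ A] (s : Finset ι)
    (D : ι → Derivation ℂ A A) (p : A) : (∑ i ∈ s, D i) p = ∑ i ∈ s, D i p := by
  classical
  induction s using Finset.induction_on with
  | empty => simp
  | insert a s ha ih => rw [Finset.sum_insert ha, Finset.sum_insert ha, Derivation.add_apply, ih]

theorem symDer_matUnit (k : ℕ) (a b : ℕ+) (p : PolyRep k) :
    symDer k (matUnit a b) p =
      ∑ j : Fin k, MvPolynomial.X (a, j) * MvPolynomial.pderiv (b, j) p := by
  have : symDer k (matUnit a b) = ∑ j : Fin k,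
      (MvPolynomial.X (a, j) : PolyRep k) • MvPolynomial.pderiv (b, j) := by
    refine MvPolynomial.derivation_ext fun q => ?_
    obtain ⟨c, l⟩ := q
    rw [symDer_X, matUnit_single, derivation_sum_apply]
    simp only [Derivation.smul_apply, MvPolynomial.pderiv_X, smul_eq_mul]
    by_cases h : c = b
    · subst h
      rw [Finset.sum_eq_single l]
      · simp [colEmb]
      · intro j _ hj
        simp [hj.symm]
      · simp
    · rw [if_neg h, map_zero, Finset.sum_eq_zero]
      intro j _
      simp [h]
  rw [this, derivation_sum_apply]
  simp

theorem derivation_prod {ι A : Type*} [DecidableEq ι] [CommRing A] [Algebra ℂ A]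
    (D : Derivation ℂ A A) (s : Finset ι) (f : ι → A) :
    D (∏ i ∈ s, f i) = ∑ i ∈ s, D (f i) * ∏ j ∈ s.erase i, f j := by
  induction s using Finset.induction_on with
  | empty => simp
  | insert a s ha ih =>
    rw [Finset.prod_insert ha, Derivation.leibniz, ih, Finset.sum_insert ha,
      Finset.erase_insert ha, add_comm]
    congr 1
    · rw [smul_eq_mul, mul_comm]
    · rw [smul_eq_mul, Finset.mul_sum]
      refine Finset.sum_congr rfl fun i hi => ?_
      have hia : i ≠ a := fun h => ha (h ▸ hi)
      rw [Finset.erase_insert_of_ne hia.symm, Finset.prod_insert]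
      · ring
      · simp [ha]

theorem derivation_det {A : Type*} [CommRing A] [Algebra ℂ A] (D : Derivation ℂ A A) {m : ℕ}
    (M : Matrix (Fin m) (Fin m) A) :
    D M.det = ∑ i, (M.updateRow i fun l => D (M i l)).det := by
  have key : ∀ N : Matrix (Fin m) (Fin m) A,
      N.det = ∑ σ : Equiv.Perm (Fin m), Equiv.Perm.sign σ • ∏ i, N i (σ i) := by
    intro N
    rw [← Matrix.det_transpose, Matrix.det_apply]
    rfl
  rw [key, map_sum]
  simp only [key]
  rw [Finset.sum_comm]
  refine Finset.sum_congr rfl fun σ _ => ?_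
  rw [← Finset.smul_sum]
  have : ∀ (z : ℤˣ) (x : A), D (z • x) = z • D x := by
    intro z x
    rw [Units.smul_def, Units.smul_def, map_zsmul]
  rw [this, derivation_prod]
  congr 1
  refine Finset.sum_congr rfl fun i _ => ?_
  rw [← Finset.mul_prod_erase Finset.univ _ (Finset.mem_univ i)]
  congr 1
  · simp
  · refine Finset.prod_congr rfl fun j hj => ?_
    rw [Matrix.updateRow_ne (Finset.ne_of_mem_erase hj)]

theorem symDer_leadMinor (k m : ℕ) (hm : m ≤ k) (a b : ℕ+) (hab : a ≤ b) :
    symDer k (matUnit a b) (leadMinor k m hm) =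
      (if a = b ∧ (a : ℕ) ≤ m then (1 : ℂ) else 0) • leadMinor k m hm := by
  have hidx : ∀ c : ℕ+, (c : ℕ) ≤ m → ∃ i : Fin m, (i : ℕ).succPNat = c := by
    intro c hc
    have := c.pos
    exact ⟨⟨c - 1, by omega⟩, PNat.eq (by simp [Nat.succPNat]; omega)⟩
  rw [leadMinor, derivation_det]
  have hrow : ∀ i l : Fin m, symDer k (matUnit a b)
      (MvPolynomial.X ((i : ℕ).succPNat, Fin.castLE hm l)) =
      if (i : ℕ).succPNat = b then MvPolynomial.X (a, Fin.castLE hm l) else 0 := by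
    intro i l
    rw [symDer_X, matUnit_single]
    split_ifs <;> simp [colEmb]
  simp only [Matrix.of_apply, hrow]
  by_cases hbm : (b : ℕ) ≤ m
  · obtain ⟨i, hi⟩ := hidx b hbm
    rw [Finset.sum_eq_single i]
    · obtain ⟨i', hi'⟩ := hidx a (le_trans (PNat.coe_le_coe _ _ |>.2 hab) hbm)
      by_cases h : a = b
      · subst h
        have e : (i : ℕ).succPNat = a := hi
        rw [if_pos ⟨rfl, hbm⟩, one_smul]
        congr 1
        ext1 p q
        by_cases hp : p = i
        · subst hp; simp [e]
        · rw [Matrix.updateRow_ne hp]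
      · rw [if_neg (fun hh => h hh.1), zero_smul]
        have hne : i' ≠ i := by
          rintro rfl
          exact h (hi'.symm.trans hi)
        refine Matrix.det_zero_of_row_eq hne ?_
        funext q
        rw [Matrix.updateRow_ne hne, Matrix.updateRow_self]
        simp [hi, hi']
    · intro p _ hp
      refine Matrix.det_eq_zero_of_row_eq_zero p fun q => ?_
      rw [Matrix.updateRow_self, if_neg]
      intro h
      apply hp
      have := h.trans hi.symm
      have := congrArg PNat.val this
      simp at this
      exact Fin.ext this
    · simp
  · rw [if_neg, zero_smul, Finset.sum_eq_zero]
    · intro p _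
      refine Matrix.det_eq_zero_of_row_eq_zero p fun q => ?_
      rw [Matrix.updateRow_self, if_neg]
      rintro rfl
      have := p.isLt
      simp at hbm
    · rintro ⟨rfl, h⟩
      exact hbm h

theorem derivation_prod_pow {ι A : Type*} [CommRing A] [Algebra ℂ A]
    (D : Derivation ℂ A A) (s : Finset ι) (f : ι → A) (c : ι → ℂ) (e : ι → ℕ)
    (h : ∀ i, D (f i) = c i • f i) :
    D (∏ i ∈ s, f i ^ e i) = (∑ i ∈ s, (e i : ℂ) * c i) • ∏ i ∈ s, f i ^ e i := by
  classical
  have hp : ∀ i, D (f i ^ e i) = ((e i : ℂ) * c i) • f i ^ e i := by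
    intro i
    rw [Derivation.leibniz_pow, h]
    rcases Nat.eq_zero_or_pos (e i) with h0 | h0
    · simp [h0]
    · obtain ⟨n, hn⟩ : ∃ n, e i = n + 1 := ⟨e i - 1, by omega⟩
      rw [hn, Nat.add_sub_cancel, smul_eq_mul, mul_smul_comm, ← pow_succ, mul_smul,
        Nat.cast_smul_eq_nsmul]
  rw [derivation_prod, Finset.sum_smul]
  refine Finset.sum_congr rfl fun i hi => ?_
  rw [hp, smul_mul_assoc, Finset.mul_prod_erase s (fun i => f i ^ e i) hi]

theorem sum_partAt {k : ℕ} (μ : Fin k → ℕ) (hμ : Antitone μ) (a : ℕ) :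
    ∑ j : Fin k, (if a ≤ (j : ℕ) then μ j - partAt μ (j + 1) else 0) = partAt μ a := by
  have hanti : Antitone (partAt μ) := by
    intro x y hxy
    unfold partAt
    split_ifs with h1 h2
    · exact hμ (by simpa using hxy)
    · omega
    · exact Nat.zero_le _
    · exact le_rfl
  have hk : partAt μ k = 0 := by simp [partAt]
  have e : ∀ j : Fin k, (if a ≤ (j : ℕ) then μ j - partAt μ (j + 1) else 0) =
      (fun j : ℕ => if a ≤ j then partAt μ j - partAt μ (j + 1) else 0) j := by
    intro j
    simp [partAt]
  rw [Finset.sum_congr rfl fun j _ => e j, Fin.sum_univ_eq_sum_range (fun j : ℕ =>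
    if a ≤ j then partAt μ j - partAt μ (j + 1) else 0) k]
  have gen : ∀ n, a ≤ n → ∑ j ∈ Finset.range n,
      (if a ≤ j then partAt μ j - partAt μ (j + 1) else 0) = partAt μ a - partAt μ n := by
    intro n hn
    induction n, hn using Nat.le_induction with
    | base =>
      rw [Finset.sum_eq_zero, Nat.sub_self]
      intro j hj
      have := Finset.mem_range.1 hj
      rw [if_neg (by omega)]
    | succ n hn ih =>
      rw [Finset.sum_range_succ, ih, if_pos hn]
      have h1 := hanti hn
      have h2 := hanti (Nat.le_succ n)
      simp only [Nat.succ_eq_add_one] at h2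
      omega
  by_cases hak : a ≤ k
  · rw [gen k hak, hk, Nat.sub_zero]
  · rw [Finset.sum_eq_zero]
    · simp [partAt]; omega
    · intro j hj
      have := Finset.mem_range.1 hj
      rw [if_neg (by omega)]

/-- The highest weight vector is killed by `E_{ab}` for `a < b`, and has weight `μ`. -/
theorem symDer_hwVec {k : ℕ} (μ : Fin k → ℕ) (hμ : Antitone μ) (a b : ℕ+) (hab : a ≤ b) :
    symDer k (matUnit a b) (hwVec μ) =
      (if a = b then (partAt μ (a - 1) : ℂ) else 0) • hwVec μ := by
  unfold hwVec
  rw [derivation_prod_pow (symDer k (matUnit a b)) Finset.univ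
    (fun j : Fin k => leadMinor k (j + 1) j.isLt) _ _
    (fun j : Fin k => symDer_leadMinor k (j + 1) j.isLt a b hab)]
  congr 1
  by_cases h : a = b
  · subst h
    rw [if_pos rfl, ← sum_partAt μ hμ, Nat.cast_sum]
    refine Finset.sum_congr rfl fun j _ => ?_
    have := a.pos
    by_cases h2 : (a : ℕ) ≤ j + 1
    · rw [if_pos ⟨rfl, h2⟩, if_pos (by omega), mul_one]
    · rw [if_neg (fun hh => h2 hh.2), if_neg (by omega)]; simp
  · simp [h]

theorem hwVec_ne_zero {k : ℕ} (μ : Fin k → ℕ) : hwVec μ ≠ 0 := by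
  unfold hwVec
  refine Finset.prod_ne_zero_iff.2 fun j _ => pow_ne_zero _ ?_
  intro h0
  have hm : (j : ℕ) + 1 ≤ k := j.isLt
  have := congrArg (MvPolynomial.eval fun q : ℕ+ × Fin k =>
    if (q.1 : ℕ) = q.2 + 1 then (1 : ℂ) else 0) h0
  rw [leadMinor, RingHom.map_det, map_zero] at this
  have h1 : (MvPolynomial.eval fun q : ℕ+ × Fin k =>
      if (q.1 : ℕ) = q.2 + 1 then (1 : ℂ) else 0).mapMatrix (Matrix.of fun a l : Fin (j + 1) =>
    (MvPolynomial.X ((a : ℕ).succPNat, Fin.castLE hm l) : PolyRep k)) = 1 := by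
    ext a l
    simp [Matrix.one_apply, Fin.ext_iff]
  rw [h1, Matrix.det_one] at this
  exact one_ne_zero this

/-- The symmetric bilinear form for which the monomials `x^m` are orthogonal with norms `m!`. -/
noncomputable def fischer (k : ℕ) : PolyRep k →ₗ[ℂ] PolyRep k →ₗ[ℂ] ℂ :=
  (MvPolynomial.basisMonomials (ℕ+ × Fin k) ℂ).constr ℂ fun m =>
    ((m.prod fun _ e => e.factorial : ℕ) : ℂ) • MvPolynomial.lcoeff ℂ m

theorem fischer_monomial (k : ℕ) (m : ℕ+ × Fin k →₀ ℕ) (q : PolyRep k) :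
    fischer k (MvPolynomial.monomial m 1) q =
      ((m.prod fun _ e => e.factorial : ℕ) : ℂ) * MvPolynomial.coeff m q := by
  have := (MvPolynomial.basisMonomials (ℕ+ × Fin k) ℂ).constr_basis ℂ (fun m =>
    ((m.prod fun _ e => e.factorial : ℕ) : ℂ) • MvPolynomial.lcoeff ℂ m) m
  rw [MvPolynomial.coe_basisMonomials] at this
  rw [fischer, this]
  simp

theorem fischer_X_mul (k : ℕ) (i : ℕ+ × Fin k) (p q : PolyRep k) :
    fischer k (MvPolynomial.X i * p) q = fischer k p (MvPolynomial.pderiv i q) := by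
  have : (fischer k).comp (LinearMap.mulLeft ℂ (MvPolynomial.X i : PolyRep k)) =
      (LinearMap.lcomp ℂ ℂ (MvPolynomial.pderiv i).toLinearMap).comp (fischer k) := by
    refine (MvPolynomial.basisMonomials (ℕ+ × Fin k) ℂ).ext fun m => LinearMap.ext fun q => ?_
    simp only [MvPolynomial.coe_basisMonomials, LinearMap.comp_apply, LinearMap.mulLeft_apply,
      LinearMap.lcomp_apply]
    have hX : (MvPolynomial.X i * MvPolynomial.monomial m 1 : PolyRep k) =
        MvPolynomial.monomial (m + Finsupp.single i 1) 1 := by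
      rw [MvPolynomial.X, MvPolynomial.monomial_mul, add_comm, one_mul]
    rw [hX, fischer_monomial, fischer_monomial]
    change _ = _ * MvPolynomial.coeff m (MvPolynomial.pderiv i q)
    rw [MvPolynomial.coeff_pderiv]
    have hf : ((m + Finsupp.single i 1).prod fun _ e => e.factorial) =
        (m i + 1) * m.prod fun _ e => e.factorial := by
      classical
      rw [← Finsupp.mul_prod_erase' (m + Finsupp.single i 1) i _ (by simp),
        ← Finsupp.mul_prod_erase' m i _ (by simp), Finsupp.erase_add]
      simp [Nat.factorial_succ, mul_assoc]
    rw [hf]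
    push_cast
    ring
  exact LinearMap.congr_fun (LinearMap.congr_fun this p) q

theorem fischer_symm (k : ℕ) (p q : PolyRep k) : fischer k p q = fischer k q p := by
  have : fischer k = (fischer k).flip := by
    refine (MvPolynomial.basisMonomials (ℕ+ × Fin k) ℂ).ext fun m =>
      (MvPolynomial.basisMonomials (ℕ+ × Fin k) ℂ).ext fun m' => ?_
    simp only [MvPolynomial.coe_basisMonomials, LinearMap.flip_apply, fischer_monomial,
      MvPolynomial.coeff_monomial]
    by_cases h : m = m'
    · subst h; simp
    · simp [h, Ne.symm h]
  exact LinearMap.congr_fun (LinearMap.congr_fun this p) q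

theorem fischer_adj (k : ℕ) (a b : ℕ+) (p q : PolyRep k) :
    fischer k ⁅matUnit a b, p⁆ q = fischer k p ⁅matUnit b a, q⁆ := by
  rw [lie_sym_apply, lie_sym_apply, symDer_matUnit, symDer_matUnit, map_sum, map_sum,
    LinearMap.sum_apply]
  refine Finset.sum_congr rfl fun j _ => ?_
  rw [fischer_X_mul, fischer_symm, ← fischer_X_mul, fischer_symm]

theorem fischer_conj_ne_zero (k : ℕ) (p : PolyRep k) (hp : p ≠ 0) :
    fischer k p (MvPolynomial.map (starRingEnd ℂ) p) ≠ 0 := by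
  have e : fischer k p (MvPolynomial.map (starRingEnd ℂ) p) =
      ((∑ m ∈ p.support, (m.prod fun _ e => e.factorial : ℕ) * ‖MvPolynomial.coeff m p‖ ^ 2 : ℝ)
        : ℂ) := by
    have hs : ∀ q, fischer k p q = ∑ m ∈ p.support,
        fischer k (MvPolynomial.monomial m (MvPolynomial.coeff m p)) q := by
      intro q
      rw [← LinearMap.sum_apply, ← map_sum, ← p.as_sum]
    rw [hs]
    simp only [Complex.ofReal_sum, Complex.ofReal_mul, Complex.ofReal_natCast, Complex.ofReal_pow]
    refine Finset.sum_congr rfl fun m _ => ?_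
    have : (MvPolynomial.monomial m (MvPolynomial.coeff m p) : PolyRep k) =
        MvPolynomial.coeff m p • MvPolynomial.monomial m 1 := by
      rw [MvPolynomial.smul_monomial, smul_eq_mul, mul_one]
    rw [this, map_smul, LinearMap.smul_apply, fischer_monomial, MvPolynomial.coeff_map,
      ← Complex.mul_conj', smul_eq_mul]
    ring
  rw [e, Complex.ofReal_ne_zero]
  refine ne_of_gt (Finset.sum_pos (fun m hm => ?_) ?_)
  · have h1 : 0 < ‖MvPolynomial.coeff m p‖ := norm_pos_iff.2 (MvPolynomial.mem_support_iff.1 hm)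
    have h2 : 0 < (m.prod fun _ e => e.factorial) :=
      Finset.prod_pos fun i _ => Nat.factorial_pos _
    positivity
  · exact MvPolynomial.support_nonempty.2 hp

/-- Vectors obtained from the highest weight vector by lowering operators `E_{ab}`, `b < a ≤ n+1`. -/
inductive IsLowered {k : ℕ} (μ : Fin k → ℕ) (n : ℕ) : PolyRep k → Prop
  | base : IsLowered μ n (hwVec μ)
  | step (p : PolyRep k) (a b : ℕ+) (hab : b < a) (ha : (a : ℕ) ≤ n + 1) (hp : IsLowered μ n p) :
      IsLowered μ n ⁅matUnit a b, p⁆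

theorem matUnit_mem_slFin {n : ℕ} {a b : ℕ+} (h : a ≠ b) (ha : (a : ℕ) ≤ n + 1)
    (hb : (b : ℕ) ≤ n + 1) : matUnit a b ∈ slFin n :=
  Submodule.subset_span ⟨a, ha, b, hb, h, Or.inl rfl⟩

theorem lie_isLowered {k : ℕ} (μ : Fin k → ℕ) (hμ : Antitone μ) (n : ℕ) (p : PolyRep k)
    (hp : IsLowered μ n p) (x : Module.End ℂ NatRep) (hx : x ∈ slFin n) :
    ⁅x, p⁆ ∈ Submodule.span ℂ {q | IsLowered μ n q} := by
  induction hp generalizing x with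
  | base =>
    have hx' := mem_slOn.1 hx
    induction hx' using Submodule.span_induction with
    | zero => simp
    | add a b _ _ ha hb => rw [add_lie]; exact Submodule.add_mem _ (ha ‹_›) (hb ‹_›)
    | smul c a _ ha => rw [smul_lie]; exact Submodule.smul_mem _ _ (ha ‹_›)
    | mem y hy =>
      have hd : ∀ i : ℕ+, ⁅matUnit i i, hwVec μ⁆ ∈ Submodule.span ℂ {q | IsLowered μ n q} := by
        intro i
        rw [lie_sym_apply, symDer_hwVec μ hμ i i le_rfl]
        exact Submodule.smul_mem _ _ (Submodule.subset_span .base)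
      obtain ⟨i, hi, j, hj, hij, rfl | rfl⟩ := hy
      · rcases lt_or_gt_of_ne hij with h | h
        · rw [lie_sym_apply, symDer_hwVec μ hμ i j h.le, if_neg hij, zero_smul]
          exact Submodule.zero_mem _
        · exact Submodule.subset_span (IsLowered.step _ i j h hi .base)
      · rw [sub_lie]
        exact Submodule.sub_mem _ (hd i) (hd j)
  | step p a b hab ha hp ih =>
    have hT : ∀ t ∈ Submodule.span ℂ {q | IsLowered μ n q},
        ⁅matUnit a b, t⁆ ∈ Submodule.span ℂ {q | IsLowered μ n q} := by
      intro t ht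
      induction ht using Submodule.span_induction with
      | zero => simp
      | add a b _ _ ha hb => rw [lie_add]; exact Submodule.add_mem _ ha hb
      | smul c a _ ha => rw [lie_smul]; exact Submodule.smul_mem _ _ ha
      | mem t ht => exact Submodule.subset_span (IsLowered.step _ a b hab ha ht)
    have hE : matUnit a b ∈ slFin n := matUnit_mem_slFin hab.ne' ha
      (le_trans (PNat.coe_le_coe _ _ |>.2 hab.le) ha)
    rw [leibniz_lie]
    exact Submodule.add_mem _ (ih _ ((slFin n).lie_mem hx hE)) (hT _ (ih x hx))

theorem mem_schurStage {k : ℕ} (μ : Fin k → ℕ) (hμ : Antitone μ) (n : ℕ) (p : PolyRep k) :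
    p ∈ schurStage μ n ↔ p ∈ Submodule.span ℂ {q | IsLowered μ n q} := by
  constructor
  · let T : LieSubmodule ℂ (slFin n) (PolyRep k) :=
      { Submodule.span ℂ {q | IsLowered μ n q} with
        lie_mem := by
          intro x t ht
          change t ∈ Submodule.span ℂ {q | IsLowered μ n q} at ht
          change ⁅(x : Module.End ℂ NatRep), t⁆ ∈ Submodule.span ℂ {q | IsLowered μ n q}
          induction ht using Submodule.span_induction with
          | zero => simp
          | add a b _ _ ha hb => rw [lie_add]; exact Submodule.add_mem _ ha hb
          | smul c a _ ha => rw [lie_smul]; exact Submodule.smul_mem _ _ ha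
          | mem t ht => exact lie_isLowered μ hμ n t ht x x.2 }
    have : schurStage μ n ≤ T := LieSubmodule.lieSpan_le.2 (by
      rintro _ rfl
      exact Submodule.subset_span (IsLowered.base (μ := μ) (n := n)))
    exact fun hp => this hp
  · intro hp
    have : Submodule.span ℂ {q | IsLowered μ n q} ≤ (schurStage μ n).toSubmodule := by
      refine Submodule.span_le.2 fun q hq => ?_
      change q ∈ schurStage μ n
      induction hq with
      | base => exact LieSubmodule.subset_lieSpan rfl
      | step p a b hab ha hp ih =>
        exact (schurStage μ n).lie_mem (x := ⟨matUnit a b, matUnit_mem_slFin hab.ne' ha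
          (le_trans (PNat.coe_le_coe _ _ |>.2 hab.le) ha)⟩) ih
    exact this hp

theorem lie_map_conj {k : ℕ} (a b : ℕ+) (p : PolyRep k) :
    MvPolynomial.map (starRingEnd ℂ) ⁅matUnit a b, p⁆ =
      ⁅matUnit a b, MvPolynomial.map (starRingEnd ℂ) p⁆ := by
  simp only [lie_sym_apply, symDer_matUnit, map_sum, map_mul, MvPolynomial.map_X,
    MvPolynomial.pderiv_map]

theorem map_conj_isLowered {k : ℕ} (μ : Fin k → ℕ) (n : ℕ) (p : PolyRep k)
    (hp : IsLowered μ n p) : MvPolynomial.map (starRingEnd ℂ) p = p := by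
  induction hp with
  | base =>
    rw [hwVec, map_prod]
    refine Finset.prod_congr rfl fun j _ => ?_
    rw [map_pow, leadMinor, RingHom.map_det]
    congr 2
    ext1 a b
    simp
  | step p a b _ _ _ ih => rw [lie_map_conj, ih]

/-- A diagonal element for which all `E_{ab}` with `b < a ≤ n+1` lower the eigenvalue. -/
noncomputable def gradElt (n : ℕ) : Module.End ℂ NatRep :=
  ∑ c ∈ Finset.Icc (1 : ℕ+) n.succPNat, ((c : ℕ) : ℂ) • (matUnit 1 1 - matUnit c c)

theorem gradElt_mem (n : ℕ) : gradElt n ∈ slFin n := by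
  refine Submodule.sum_mem _ fun c hc => Submodule.smul_mem _ _ ?_
  have hc' : (c : ℕ) ≤ n + 1 := PNat.coe_le_coe _ _ |>.2 (Finset.mem_Icc.1 hc).2
  by_cases h : (1 : ℕ+) = c
  · subst h; simp
  · exact Submodule.subset_span ⟨1, by simp, c, hc', h, Or.inr rfl⟩

theorem gradElt_lie (n : ℕ) (a b : ℕ+) (hab : b < a) (ha : (a : ℕ) ≤ n + 1) :
    ∃ r : ℕ, 1 ≤ r ∧ ⁅gradElt n, matUnit a b⁆ = (-(r : ℂ)) • matUnit a b := by
  have hE : ∀ c : ℕ+, ⁅matUnit c c, matUnit a b⁆ =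
      ((if a = c then (1 : ℂ) else 0) - (if c = b then 1 else 0)) • matUnit a b := by
    intro c
    rw [matUnit_lie, sub_smul]
    congr 1
    · split_ifs with h
      · subst h; simp
      · simp
    · split_ifs with h
      · subst h; simp
      · simp
  have ha1 : a ≠ 1 := fun h => by subst h; exact absurd hab (not_lt.2 (one_le))
  have haF : a ∈ Finset.Icc (1 : ℕ+) n.succPNat :=
    Finset.mem_Icc.2 ⟨one_le, PNat.coe_le_coe _ _ |>.1 ha⟩
  have hbF : b ∈ Finset.Icc (1 : ℕ+) n.succPNat :=
    Finset.mem_Icc.2 ⟨one_le, hab.le.trans (Finset.mem_Icc.1 haF).2⟩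
  have hlt : (b : ℕ) < a := hab
  refine ⟨(if 1 = b then ∑ c ∈ Finset.Icc (1 : ℕ+) n.succPNat, (c : ℕ) else 0) + (a - b),
    by omega, ?_⟩
  have hsum : ⁅gradElt n, matUnit a b⁆ = ∑ c ∈ Finset.Icc (1 : ℕ+) n.succPNat,
      ⁅((c : ℕ) : ℂ) • (matUnit 1 1 - matUnit c c), matUnit a b⁆ := by
    rw [endNat_lie, gradElt, Finset.sum_mul, Finset.mul_sum, ← Finset.sum_sub_distrib]
    rfl
  rw [hsum]
  simp only [smul_lie, sub_lie, hE, if_neg ha1]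
  simp only [← sub_smul, smul_smul, ← Finset.sum_smul]
  congr 1
  simp only [mul_sub, Finset.sum_sub_distrib, mul_ite, mul_one, mul_zero,
    Finset.sum_ite_eq, Finset.sum_ite_eq', if_pos haF, if_pos hbF]
  push_cast [Nat.cast_sub hlt.le]
  split_ifs
  · simp; ring
  · simp

theorem isLowered_eigen {k : ℕ} (μ : Fin k → ℕ) (hμ : Antitone μ) (n : ℕ) :
    ∃ l : ℂ, ⁅gradElt n, hwVec μ⁆ = l • hwVec μ ∧ ∀ p, IsLowered μ n p →
      p = hwVec μ ∨ (fischer k (hwVec μ) p = 0 ∧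
        ∃ r : ℕ, 1 ≤ r ∧ ⁅gradElt n, p⁆ = (l - r) • p) := by
  obtain ⟨l, hl⟩ : ∃ l : ℂ, ⁅gradElt n, hwVec μ⁆ = l • hwVec μ := by
    have hd : ∀ i : ℕ+, ⁅matUnit i i, hwVec μ⁆ = (partAt μ (i - 1) : ℂ) • hwVec μ := by
      intro i
      rw [lie_sym_apply, symDer_hwVec μ hμ i i le_rfl, if_pos rfl]
    refine ⟨∑ c ∈ Finset.Icc (1 : ℕ+) n.succPNat, ((c : ℕ) : ℂ) *
      (partAt μ ((1 : ℕ+) - 1) - partAt μ (c - 1)), ?_⟩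
    rw [gradElt, Finset.sum_smul, sum_lie]
    refine Finset.sum_congr rfl fun c _ => ?_
    rw [smul_lie, sub_lie, hd, hd, ← sub_smul, smul_smul]
  refine ⟨l, hl, fun p hp => ?_⟩
  induction hp with
  | base => exact Or.inl rfl
  | step p a b hab ha hp ih =>
    right
    constructor
    · rw [fischer_symm, fischer_adj, lie_sym_apply, symDer_hwVec μ hμ b a hab.le,
        if_neg hab.ne, zero_smul, map_zero]
    · obtain ⟨r, hr, hre⟩ := gradElt_lie n a b hab ha
      obtain ⟨r', hp'⟩ : ∃ r' : ℕ, ⁅gradElt n, p⁆ = (l - r') • p := by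
        rcases ih with rfl | ⟨-, r', -, h⟩
        · exact ⟨0, by simpa using hl⟩
        · exact ⟨r', h⟩
      refine ⟨r + r', by omega, ?_⟩
      rw [leibniz_lie, hre, hp', smul_lie, lie_smul, ← add_smul]
      congr 1
      push_cast
      ring

/-- Extraction of the highest weight vector from an element of an invariant subspace. -/
theorem extract_hw {k : ℕ} (h : Module.End ℂ NatRep) (N : Submodule ℂ (PolyRep k))
    (hN : ∀ p ∈ N, ⁅h, p⁆ ∈ N) (v : PolyRep k) (l : ℂ) (hv : ⁅h, v⁆ = l • v) (R : ℕ) :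
    ∀ (c : ℂ) (y : PolyRep k), c ≠ 0 →
      y ∈ Submodule.span ℂ {p : PolyRep k | ∃ r : ℕ, 1 ≤ r ∧ r ≤ R ∧ ⁅h, p⁆ = (l - r) • p} →
      c • v + y ∈ N → v ∈ N := by
  induction R with
  | zero =>
    intro c y hc hy hN'
    have : y = 0 := by
      have he : {p : PolyRep k | ∃ r : ℕ, 1 ≤ r ∧ r ≤ 0 ∧ ⁅h, p⁆ = (l - r) • p} = ∅ := by
        ext p
        simp only [Set.mem_ofPred_eq, Set.mem_empty_iff_false, iff_false]
        rintro ⟨r, h1, h2, -⟩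
        omega
      simpa [he] using hy
    rw [this, add_zero] at hN'
    exact (Submodule.smul_mem_iff _ hc).1 hN'
  | succ R ih =>
    intro c y hc hy hN'
    refine ih (((R + 1 : ℕ) : ℂ) * c) (⁅h, y⁆ - (l - ((R + 1 : ℕ) : ℂ)) • y)
      (mul_ne_zero (Nat.cast_ne_zero.2 (Nat.succ_ne_zero R)) hc) ?_ ?_
    · clear hN'
      induction hy using Submodule.span_induction with
      | zero => simp
      | add a b _ _ ha hb =>
        rw [lie_add, smul_add, add_sub_add_comm]
        exact Submodule.add_mem _ ha hb
      | smul d a _ ha =>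
        rw [lie_smul, smul_comm _ d, ← smul_sub]
        exact Submodule.smul_mem _ _ ha
      | mem p hp =>
        obtain ⟨r, h1, h2, hp⟩ := hp
        rw [hp, ← sub_smul]
        rcases Nat.lt_or_ge R r with h3 | h3
        · have : r = R + 1 := by omega
          subst this
          simp
        · exact Submodule.smul_mem _ _ (Submodule.subset_span ⟨r, h1, h3, hp⟩)
    · have := N.sub_mem (hN _ hN') (N.smul_mem (l - ((R + 1 : ℕ) : ℂ)) hN')
      convert this using 1
      rw [lie_add, lie_smul, hv]
      module

/-- The stages `L(μ)` are simple `𝔤_n`-modules. -/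
theorem schurStage_irreducible {k : ℕ} (μ : Fin k → ℕ) (hμ : Antitone μ) (n : ℕ) :
    LieModule.IsIrreducible ℂ (slFin n) (schurStage μ n) := by
  have hvW : hwVec μ ∈ schurStage μ n := LieSubmodule.subset_lieSpan rfl
  have hnt : Nontrivial (schurStage μ n) :=
    ⟨⟨⟨hwVec μ, hvW⟩, 0, fun h => hwVec_ne_zero μ (congrArg Subtype.val h)⟩⟩
  refine LieModule.IsIrreducible.mk fun N hN => ?_
  set N' : Submodule ℂ (PolyRep k) := N.toSubmodule.map (schurStage μ n).toSubmodule.subtype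
    with hN'
  have hmem : ∀ p : schurStage μ n, p ∈ N ↔ (p : PolyRep k) ∈ N' := by
    intro p
    constructor
    · exact fun hp => ⟨p, hp, rfl⟩
    · rintro ⟨q, hq, hqp⟩
      have : q = p := Subtype.ext hqp
      exact this ▸ hq
  have hsub : ∀ p ∈ N', p ∈ schurStage μ n := by
    rintro _ ⟨q, -, rfl⟩
    exact q.2
  have hstab : ∀ x ∈ slFin n, ∀ p ∈ N', ⁅x, p⁆ ∈ N' := by
    rintro x hx _ ⟨q, hq, rfl⟩
    have h := N.lie_mem (x := (⟨x, hx⟩ : slFin n)) (m := q) hq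
    exact ⟨_, h, rfl⟩
  suffices hv : hwVec μ ∈ N' by
    rw [eq_top_iff]
    rintro ⟨p, hp⟩ -
    rw [hmem]
    have hp' := (mem_schurStage μ hμ n p).1 hp
    have hle : Submodule.span ℂ {q | IsLowered μ n q} ≤ N' := by
      refine Submodule.span_le.2 fun q hq => ?_
      change q ∈ N'
      induction hq with
      | base => exact hv
      | step p a b hab ha _ ih =>
        exact hstab _ (matUnit_mem_slFin hab.ne' ha
          (le_trans (PNat.coe_le_coe _ _ |>.2 hab.le) ha)) _ ih
    exact hle hp'
  obtain ⟨l, hl, hlow⟩ := isLowered_eigen μ hμ n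
  have hex : ∃ x ∈ N', fischer k (hwVec μ) x ≠ 0 := by
    by_contra! hall
    have hlowN : ∀ q, IsLowered μ n q → ∀ x ∈ N', fischer k q x = 0 := by
      intro q hq
      induction hq with
      | base => exact hall
      | step p a b hab ha _ ih =>
        intro x hx
        rw [fischer_adj]
        exact ih _ (hstab _ (matUnit_mem_slFin hab.ne
          (le_trans (PNat.coe_le_coe _ _ |>.2 hab.le) ha) ha) _ hx)
    have hspan : ∀ q ∈ Submodule.span ℂ {q | IsLowered μ n q}, ∀ x ∈ N',
        fischer k q x = 0 ∧ fischer k x (MvPolynomial.map (starRingEnd ℂ) q) = 0 := by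
      intro q hq x hx
      induction hq using Submodule.span_induction with
      | zero => simp
      | add a b _ _ ha hb => simp [ha.1, ha.2, hb.1, hb.2]
      | smul c a _ ha =>
        refine ⟨by simp [ha.1], ?_⟩
        rw [MvPolynomial.smul_eq_C_mul, map_mul, MvPolynomial.map_C,
          ← MvPolynomial.smul_eq_C_mul, map_smul, ha.2, smul_zero]
      | mem q hq =>
        rw [map_conj_isLowered μ n q hq, fischer_symm k x q]
        exact ⟨hlowN q hq x hx, hlowN q hq x hx⟩
    obtain ⟨x, hx, hx0⟩ : ∃ x ∈ N, x ≠ 0 := by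
      by_contra! h0
      exact hN ((LieSubmodule.eq_bot_iff _).2 h0)
    have hx' := (hmem x).1 hx
    have := (hspan x ((mem_schurStage μ hμ n x).1 (hsub x hx')) x hx').2
    exact fischer_conj_ne_zero k x (fun h => hx0 (Subtype.ext h)) this
  obtain ⟨x, hx, hx0⟩ := hex
  have hdec : ∀ t ∈ Submodule.span ℂ {q | IsLowered μ n q}, ∃ (c : ℂ) (y : PolyRep k) (R : ℕ),
      t = c • hwVec μ + y ∧ fischer k (hwVec μ) y = 0 ∧ y ∈ Submodule.span ℂ
        {p : PolyRep k | ∃ r : ℕ, 1 ≤ r ∧ r ≤ R ∧ ⁅gradElt n, p⁆ = (l - r) • p} := by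
    intro t ht
    induction ht using Submodule.span_induction with
    | zero => exact ⟨0, 0, 0, by simp, by simp, Submodule.zero_mem _⟩
    | add a b _ _ ha hb =>
      obtain ⟨c, y, R, rfl, h1, h2⟩ := ha
      obtain ⟨c', y', R', rfl, h1', h2'⟩ := hb
      refine ⟨c + c', y + y', max R R', by module, by rw [map_add, h1, h1', add_zero],
        Submodule.add_mem _ (Submodule.span_mono ?_ h2) (Submodule.span_mono ?_ h2')⟩
      · rintro p ⟨r, hr, hr', hp⟩
        exact ⟨r, hr, hr'.trans (le_max_left _ _), hp⟩
      · rintro p ⟨r, hr, hr', hp⟩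
        exact ⟨r, hr, hr'.trans (le_max_right _ _), hp⟩
    | smul d a _ ha =>
      obtain ⟨c, y, R, rfl, h1, h2⟩ := ha
      exact ⟨d * c, d • y, R, by module, by rw [map_smul, h1, smul_zero],
        Submodule.smul_mem _ _ h2⟩
    | mem q hq =>
      rcases hlow q hq with rfl | ⟨h1, r, hr, h2⟩
      · exact ⟨1, 0, 0, by simp, by simp, Submodule.zero_mem _⟩
      · exact ⟨0, q, r, by simp, h1, Submodule.subset_span ⟨r, hr, le_rfl, h2⟩⟩
  obtain ⟨c, y, R, rfl, h1, h2⟩ := hdec x ((mem_schurStage μ hμ n x).1 (hsub x hx))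
  refine extract_hw (gradElt n) N' (hstab _ (gradElt_mem n)) (hwVec μ) l hl R c y ?_ h2 hx
  rintro rfl
  simp [h1] at hx0

theorem slOn_mono {s t : Set ℕ+} (h : s ⊆ t) : slOn s ≤ slOn t := by
  intro x hx
  refine Submodule.span_mono ?_ (mem_slOn.1 hx)
  rintro x ⟨i, hi, j, hj, hij⟩
  exact ⟨i, h hi, j, h hj, hij⟩

theorem slFin_mono {m n : ℕ} (h : m ≤ n) : slFin m ≤ slFin n :=
  slOn_mono fun i (hi : (i : ℕ) ≤ m + 1) => hi.trans (Nat.succ_le_succ h)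

/-- `𝔰𝔩(∞)` is the union of the subalgebras `𝔤_n`. -/
theorem exists_mem_slFin (x : Module.End ℂ NatRep) (hx : x ∈ slInf) : ∃ n, x ∈ slFin n := by
  have hx' := mem_slOn.1 hx
  clear hx
  induction hx' using Submodule.span_induction with
  | zero => exact ⟨0, (slFin 0).zero_mem⟩
  | add a b _ _ ha hb =>
    obtain ⟨m, ha⟩ := ha
    obtain ⟨n, hb⟩ := hb
    exact ⟨max m n, (slFin _).add_mem (slFin_mono (le_max_left _ _) ha)
      (slFin_mono (le_max_right _ _) hb)⟩
  | smul c a _ ha =>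
    obtain ⟨m, ha⟩ := ha
    exact ⟨m, (slFin _).smul_mem c ha⟩
  | mem x hx =>
    obtain ⟨i, -, j, -, hij⟩ := hx
    refine ⟨max i j, Submodule.subset_span ⟨i, ?_, j, ?_, hij⟩⟩
    · exact (le_max_left _ _).trans (Nat.le_succ _)
    · exact (le_max_right _ _).trans (Nat.le_succ _)

theorem schurStage_mono {k : ℕ} (μ : Fin k → ℕ) {m n : ℕ} (h : m ≤ n) (p : PolyRep k)
    (hp : p ∈ schurStage μ m) : p ∈ schurStage μ n := by
  let T : LieSubmodule ℂ (slFin m) (PolyRep k) :=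
    { (schurStage μ n).toSubmodule with
      lie_mem := fun {x t} ht =>
        (schurStage μ n).lie_mem (x := ⟨x, slFin_mono h x.2⟩) ht }
  have : schurStage μ m ≤ T := LieSubmodule.lieSpan_le.2 (by
    rintro _ rfl
    exact LieSubmodule.subset_lieSpan (R := ℂ) (L := slFin n) (s := {hwVec μ}) rfl)
  exact this hp

/-- The `𝔰𝔩(∞)`-module `S^μ V`, the direct limit (ascending union) of the simple `𝔤_n`-modules
`L(μ)` of highest weight `μ`, along embeddings that send highest weight vectors to highest weight
vectors. -/
noncomputable def schurModule {k : ℕ} (μ : Fin k → ℕ) : LieSubmodule ℂ slInf (PolyRep k) where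
  carrier := {p | ∃ n, p ∈ schurStage μ n}
  add_mem' := by
    rintro p q ⟨m, hp⟩ ⟨n, hq⟩
    exact ⟨max m n, (schurStage μ _).add_mem (schurStage_mono μ (le_max_left _ _) p hp)
      (schurStage_mono μ (le_max_right _ _) q hq)⟩
  zero_mem' := ⟨0, (schurStage μ 0).zero_mem⟩
  smul_mem' := by
    rintro c p ⟨m, hp⟩
    exact ⟨m, (schurStage μ m).smul_mem c hp⟩
  lie_mem := by
    rintro x p ⟨m, hp⟩
    obtain ⟨n, hx⟩ := exists_mem_slFin x x.2
    exact ⟨max m n, (schurStage μ _).lie_mem (x := ⟨x, slFin_mono (le_max_right _ _) hx⟩)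
      (schurStage_mono μ (le_max_left _ _) p hp)⟩

/-- The stages of the direct limit are as required: `schurStage μ n` is a simple `𝔤_n`-module with
a nonzero vector that is killed by all `E_{ab}` with `a < b ≤ n+1` and has weight `μ`, for the
Borel subalgebra given by the usual order. -/
theorem schurStage_spec {k : ℕ} (μ : Fin k → ℕ) (hμ : Antitone μ) (n : ℕ) :
    LieModule.IsIrreducible ℂ (slFin n) (schurStage μ n) ∧
    hwVec μ ∈ schurStage μ n ∧ hwVec μ ≠ 0 ∧
    (∀ a b : ℕ+, a < b → ⁅matUnit a b, hwVec μ⁆ = 0) ∧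
    ∀ a b : ℕ+, ⁅matUnit a a - matUnit b b, hwVec μ⁆ =
      ((partAt μ (a - 1) : ℂ) - partAt μ (b - 1)) • hwVec μ := by
  refine ⟨schurStage_irreducible μ hμ n, LieSubmodule.subset_lieSpan rfl, hwVec_ne_zero μ, ?_, ?_⟩
  · intro a b hab
    rw [lie_sym_apply, symDer_hwVec μ hμ a b hab.le, if_neg hab.ne, zero_smul]
  · intro a b
    rw [sub_lie, lie_sym_apply, lie_sym_apply, symDer_hwVec μ hμ a a le_rfl,
      symDer_hwVec μ hμ b b le_rfl, if_pos rfl, if_pos rfl, sub_smul]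

set_option linter.unusedSectionVars false

/-! ## Root vectors of `𝔰𝔩(∞)` -/

/-! The proof rests on a criterion: a simple weight module is aligned once it has a nonzero weight
vector killed by `nilrad r`, and conversely an aligned module always has a nonzero vector killed by
`nilrad r`, namely the image of some `1 ⊗ s`. The question becomes whether such a vector exists in
the polynomial model of `S^μ V`, where `E_{ab}` replaces row `b` by row `a`.

For the criterion (`isAligned_of_weightVector`), let `v` be the weight vector and `S = leviSpan r
v`. Applying operators `E_{ji}` with `i ≺ j` at least once to `S` spans `lowHull r S`, and `S +
lowHull r S` is a `𝔤`-submodule. The two summands meet in `0` because their weights differ: relative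
to `v`, weights in `S` have coefficient sum `0` over every class of incomparable indices, whereas
for a lowered vector the first class with nonzero sum has a negative one. This disjointness
(`disjoint_leviSpan_lowHull`) holds in every `𝔤`-module, hence also in quotients of the induced
module. It yields both that `S` is simple over the Levi component and that the induced module has
only one maximal submodule, without a PBW theorem.

If `p ≠ 0` in `S^μ V` is killed by all `E_{ij}` with `i ≺ j`, the finite set of rows occurring in
`p` is closed under passing to smaller indices (`exists_mem_vars_of_symDer_eq_zero`). It has at
least `k` elements, because `μ_k > 0` puts `S^μ V` inside the ideal of maximal minors
(`schurModule_le_minorIdeal`, `le_card_of_mem_minorIdeal`). Listing `k` of these rows so that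
predecessors come first gives the required indices.

Conversely, the given indices can be replaced by `k` indices `f` every predecessor of which is
listed earlier (`exists_initial_segment`). The product of minors `rowVec μ f` is the highest weight
vector moved to these rows. It lies in `S^μ V` by repeated application of root vectors
(`rowVec_mem_schurModule`), and `E_{ab}` with `a ≺ b` kills it because it creates two equal rows in
each minor containing row `b`. -/

/-- The element `E_{ij}` of `𝔰𝔩(∞)` for `i ≠ j` (and `0` for `i = j`). -/
noncomputable def rootVec (i j : ℕ+) : slInf :=
  if h : i ≠ j then ⟨matUnit i j, Submodule.subset_span ⟨i, trivial, j, trivial, h, Or.inl rfl⟩⟩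
  else 0

theorem coe_rootVec {i j : ℕ+} (h : i ≠ j) :
    (rootVec i j : Module.End ℂ NatRep) = matUnit i j := by
  simp [rootVec, h]

theorem rootVec_self (i : ℕ+) : rootVec i i = 0 := by simp [rootVec]

/-- The element `E_{ii} - E_{jj}` of `𝔰𝔩(∞)`. -/
noncomputable def cartanVec (i j : ℕ+) : slInf :=
  ⟨matUnit i i - matUnit j j, by
    by_cases h : i = j
    · subst h; simp
    · exact Submodule.subset_span ⟨i, trivial, j, trivial, h, Or.inr rfl⟩⟩

theorem coe_cartanVec (i j : ℕ+) :
    (cartanVec i j : Module.End ℂ NatRep) = matUnit i i - matUnit j j := rfl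

theorem cartanVec_mem (i j : ℕ+) : cartanVec i j ∈ slCartan :=
  LieSubalgebra.subset_lieSpan ⟨i, j, rfl⟩

theorem slInf_induction {P : slInf → Prop} (zero : P 0) (add : ∀ x y, P x → P y → P (x + y))
    (smul : ∀ (c : ℂ) x, P x → P (c • x)) (root : ∀ i j, i ≠ j → P (rootVec i j))
    (cartan : ∀ i j, P (cartanVec i j)) (x : slInf) : P x := by
  obtain ⟨x, hx⟩ := x
  have hx' := mem_slOn.1 hx
  suffices h : ∀ h : x ∈ slInf, P ⟨x, h⟩ from h hx
  clear hx
  induction hx' using Submodule.span_induction with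
  | zero => exact fun _ => zero
  | add a b ha hb iha ihb =>
    intro _
    exact add _ _ (iha (mem_slOn.2 ha)) (ihb (mem_slOn.2 hb))
  | smul c a ha iha =>
    intro _
    exact smul c _ (iha (mem_slOn.2 ha))
  | mem x hx =>
    intro h
    obtain ⟨i, -, j, -, hij, rfl | rfl⟩ := hx
    · convert root i j hij using 1
      exact Subtype.ext (coe_rootVec hij).symm
    · exact cartan i j

theorem cartanVec_lie_rootVec (i j a b : ℕ+) :
    ⁅cartanVec i j, rootVec a b⁆ =
      (((Finsupp.single a 1 - Finsupp.single b 1 : ℕ+ →₀ ℤ) i : ℂ) -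
        ((Finsupp.single a 1 - Finsupp.single b 1 : ℕ+ →₀ ℤ) j : ℂ)) • rootVec a b := by
  by_cases hab : a = b
  · subst hab; simp [rootVec_self]
  refine Subtype.ext ?_
  have hE : ∀ c : ℕ+, ⁅matUnit c c, matUnit a b⁆ =
      (((Finsupp.single a 1 - Finsupp.single b 1 : ℕ+ →₀ ℤ) c : ℂ)) • matUnit a b := by
    intro c
    rw [matUnit_lie, Finsupp.sub_apply, Finsupp.single_apply, Finsupp.single_apply]
    by_cases h1 : a = c <;> by_cases h2 : b = c
    · exact absurd (h1.trans h2.symm) hab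
    · subst h1; simp [Ne.symm h2, h2]
    · subst h2; simp [h1]
    · simp [h1, h2, Ne.symm h2]
  change ⁅(cartanVec i j : Module.End ℂ NatRep), (rootVec a b : Module.End ℂ NatRep)⁆ =
    _ • (rootVec a b : Module.End ℂ NatRep)
  rw [coe_rootVec hab, coe_cartanVec, sub_lie, hE, hE, sub_smul]

theorem cartanVec_lie_cartanVec (i j a b : ℕ+) : ⁅cartanVec i j, cartanVec a b⁆ = 0 := by
  refine Subtype.ext ?_
  have hE : ∀ c d : ℕ+, ⁅matUnit c c, matUnit d d⁆ = 0 := by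
    intro c d
    rw [matUnit_lie]
    by_cases h : c = d
    · subst h; simp
    · simp [h, Ne.symm h]
  rw [LieSubalgebra.coe_bracket, coe_cartanVec, coe_cartanVec, sub_lie, lie_sub, lie_sub]
  simp [hE]

/-- In the excluded case the bracket is `E_{aa} - E_{bb}`, which the convention `rootVec i i = 0`
would lose. -/
theorem rootVec_lie_rootVec {a b i j : ℕ+} (hab : a ≠ b) (hij : i ≠ j) (h : ¬ (a = j ∧ i = b)) :
    ⁅rootVec a b, rootVec i j⁆ =
      (if i = b then rootVec a j else 0) - (if a = j then rootVec i b else 0) := by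
  refine Subtype.ext ?_
  rw [LieSubalgebra.coe_bracket, coe_rootVec hab, coe_rootVec hij, matUnit_lie,
    AddSubgroupClass.coe_sub]
  congr 1
  · split_ifs with h1
    · rw [coe_rootVec fun h2 => h ⟨h2, h1⟩]
    · rfl
  · split_ifs with h1
    · rw [coe_rootVec fun h2 => h ⟨h1, h2⟩]
    · rfl

/-! ## Admissible orders -/

theorem incomp_self (r : ℕ+ → ℕ+ → Prop) [IsStrictOrder ℕ+ r] (i : ℕ+) : Incomp r i i :=
  ⟨irrefl i, irrefl i⟩

theorem Incomp.symm {r : ℕ+ → ℕ+ → Prop} {i j : ℕ+} (h : Incomp r i j) : Incomp r j i :=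
  ⟨h.2, h.1⟩

theorem mem_orderClass {r : ℕ+ → ℕ+ → Prop} [IsStrictOrder ℕ+ r] {i j : ℕ+} :
    j ∈ orderClass r i ↔ Incomp r i j := by
  constructor
  · rintro (rfl | h)
    · exact incomp_self r j
    · exact h
  · exact Or.inr

section Admissible

variable {r : ℕ+ → ℕ+ → Prop} [IsStrictOrder ℕ+ r]

/-- The classes of `i` and `l` both contain `j`, hence coincide. So incomparability is an
equivalence relation, and the next two lemmas let the order descend to its classes. -/
theorem IsAdmissible.incomp_trans (hadm : IsAdmissible r) {i j l : ℕ+} (h : Incomp r i j) (h' : Incomp r j l) :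
    Incomp r i l := by
  have e : orderClass r i = orderClass r l := by
    by_contra hne
    have := hadm i l hne
    exact (Set.eq_empty_iff_forall_notMem.1 this) j
      ⟨mem_orderClass.2 h, mem_orderClass.2 h'.symm⟩
  rw [← mem_orderClass, e]
  exact mem_orderClass.2 (incomp_self r l)

theorem IsAdmissible.lt_of_lt_of_incomp (hadm : IsAdmissible r) {i j l : ℕ+} (h : r i j)
    (h' : Incomp r j l) : r i l := by
  by_contra hil
  by_cases hli : r l i
  · exact h'.2 (_root_.trans hli h)
  · exact (hadm.incomp_trans ⟨hil, hli⟩ h'.symm).1 h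

theorem IsAdmissible.lt_of_incomp_of_lt (hadm : IsAdmissible r) {i j l : ℕ+} (h : Incomp r i j)
    (h' : r j l) : r i l := by
  by_contra hil
  by_cases hli : r l i
  · exact h.2 (_root_.trans h' hli)
  · exact (hadm.incomp_trans h.symm ⟨hil, hli⟩).1 h'

end Admissible

/-! ## The part of a weight in a class of incomparable elements -/

open Classical in
/-- The sum of the coefficients of a weight over the class of `c`. -/
noncomputable def classSum (r : ℕ+ → ℕ+ → Prop) (c : ℕ+) : (ℕ+ →₀ ℤ) →+ ℤ :=
  Finsupp.liftAddHom fun m => if Incomp r c m then AddMonoidHom.id ℤ else 0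

open Classical in
theorem classSum_single (r : ℕ+ → ℕ+ → Prop) (c m : ℕ+) (z : ℤ) :
    classSum r c (Finsupp.single m z) = if Incomp r c m then z else 0 := by
  rw [classSum, Finsupp.liftAddHom_apply_single]
  split_ifs <;> simp

/-- Weights that are negative with respect to the order on the set of classes. -/
def IsNegWeight (r : ℕ+ → ℕ+ → Prop) (β : ℕ+ →₀ ℤ) : Prop :=
  ∃ c, classSum r c β < 0 ∧ ∀ d, r d c → classSum r d β = 0

/-! ### Words in root vectors, and a triangular decomposition relative to the order -/

section Words

variable {M : Type*} [AddCommGroup M] [Module ℂ M] [LieRingModule slInf M] [LieModule ℂ slInf M]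

/-- Vectors obtained from `v` by applying root vectors of `𝔩(≺)`, with their weight relative
to `v`. -/
inductive LeviWord (r : ℕ+ → ℕ+ → Prop) (v : M) : (ℕ+ →₀ ℤ) → M → Prop
  | base : LeviWord r v 0 v
  | step {β m} (i j : ℕ+) (h : Incomp r i j) (hm : LeviWord r v β m) :
      LeviWord r v (β + (Finsupp.single i 1 - Finsupp.single j 1)) ⁅rootVec i j, m⁆

/-- Vectors obtained from `LeviWord`s by applying at least one root vector `E_{ji}` with `i ≺ j`. -/
inductive LowWord (r : ℕ+ → ℕ+ → Prop) (v : M) : (ℕ+ →₀ ℤ) → M → Prop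
  | base {β m} (i j : ℕ+) (h : r i j) (hm : LeviWord r v β m) :
      LowWord r v (β + (Finsupp.single j 1 - Finsupp.single i 1)) ⁅rootVec j i, m⁆
  | step {β m} (i j : ℕ+) (h : r i j) (hm : LowWord r v β m) :
      LowWord r v (β + (Finsupp.single j 1 - Finsupp.single i 1)) ⁅rootVec j i, m⁆

/-- The `𝔩(≺)`-submodule generated by a weight vector `v`. -/
def leviSpan (r : ℕ+ → ℕ+ → Prop) (v : M) : Submodule ℂ M :=
  Submodule.span ℂ {m | ∃ β, LeviWord r v β m}

/-- The span of the vectors obtained from `leviSpan` by applying root vectors of the opposite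
nilradical. -/
def lowSpan (r : ℕ+ → ℕ+ → Prop) (v : M) : Submodule ℂ M :=
  Submodule.span ℂ {m | ∃ β, LowWord r v β m}

theorem self_mem_leviSpan (r : ℕ+ → ℕ+ → Prop) (v : M) : v ∈ leviSpan r v :=
  Submodule.subset_span ⟨0, .base⟩

theorem span_stable {s t : Set M} (x : slInf) (h : ∀ m ∈ s, ⁅x, m⁆ ∈ Submodule.span ℂ t) {m : M}
    (hm : m ∈ Submodule.span ℂ s) : ⁅x, m⁆ ∈ Submodule.span ℂ t := by
  induction hm using Submodule.span_induction with
  | zero => simp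
  | add a b _ _ ha hb => rw [lie_add]; exact Submodule.add_mem _ ha hb
  | smul c a _ ha => rw [lie_smul]; exact Submodule.smul_mem _ _ ha
  | mem m hm => exact h m hm

theorem lie_mem_leviSpan {r : ℕ+ → ℕ+ → Prop} {v m : M} {i j : ℕ+} (h : Incomp r i j)
    (hm : m ∈ leviSpan r v) : ⁅rootVec i j, m⁆ ∈ leviSpan r v :=
  span_stable _ (by rintro _ ⟨_, hβ⟩; exact Submodule.subset_span ⟨_, .step i j h hβ⟩) hm

theorem lie_mem_lowSpan_of_leviSpan {r : ℕ+ → ℕ+ → Prop} {v m : M} {i j : ℕ+} (h : r i j)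
    (hm : m ∈ leviSpan r v) : ⁅rootVec j i, m⁆ ∈ lowSpan r v :=
  span_stable _ (by rintro _ ⟨_, hβ⟩; exact Submodule.subset_span ⟨_, .base i j h hβ⟩) hm

theorem lie_mem_lowSpan {r : ℕ+ → ℕ+ → Prop} {v m : M} {i j : ℕ+} (h : r i j)
    (hm : m ∈ lowSpan r v) : ⁅rootVec j i, m⁆ ∈ lowSpan r v :=
  span_stable _ (by rintro _ ⟨_, hβ⟩; exact Submodule.subset_span ⟨_, .step i j h hβ⟩) hm

theorem leviSpan_le {r : ℕ+ → ℕ+ → Prop} {v : M} {T : Submodule ℂ M} (hv : v ∈ T)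
    (hT : ∀ i j, Incomp r i j → ∀ m ∈ T, ⁅rootVec i j, m⁆ ∈ T) : leviSpan r v ≤ T := by
  refine Submodule.span_le.2 ?_
  rintro m ⟨β, hm⟩
  induction hm with
  | base => exact hv
  | step i j h _ ih => exact hT i j h _ ih

/-- A root `ε_i - ε_j` of the Levi component has `i` and `j` in the same class, so its two
contributions cancel. -/
theorem LeviWord.classSum_eq_zero {r : ℕ+ → ℕ+ → Prop} [IsStrictOrder ℕ+ r]
    (hadm : IsAdmissible r) {v m : M} {β : ℕ+ →₀ ℤ} (h : LeviWord r v β m) (c : ℕ+) :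
    classSum r c β = 0 := by
  induction h with
  | base => simp
  | step i j h _ ih =>
    have : Incomp r c i ↔ Incomp r c j :=
      ⟨fun h' => hadm.incomp_trans h' h, fun h' => hadm.incomp_trans h' h.symm⟩
    rw [map_add, map_sub, ih, classSum_single, classSum_single]
    by_cases h' : Incomp r c j
    · rw [if_pos h', if_pos (this.2 h')]; simp
    · rw [if_neg h', if_neg (mt this.1 h')]; simp

/-- Adding `ε_j - ε_i` moves one unit from the class of `i` to a strictly later class. The new
witness is the earlier of the class of `i` and the old witness class; if these agree, the sum there
only drops further. -/
theorem IsNegWeight.add {r : ℕ+ → ℕ+ → Prop} [IsStrictOrder ℕ+ r] (hadm : IsAdmissible r)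
    {β : ℕ+ →₀ ℤ} {i j : ℕ+} (hij : r i j) (h : IsNegWeight r β ∨ ∀ c, classSum r c β = 0) :
    IsNegWeight r (β + (Finsupp.single j 1 - Finsupp.single i 1)) := by
  have key : ∀ d, (r d i ∨ r d j ∧ ¬ Incomp r d i) →
      classSum r d (β + (Finsupp.single j 1 - Finsupp.single i 1)) = classSum r d β := by
    intro d hd
    have h1 : ¬ Incomp r d i := hd.elim (fun h h' => h'.1 h) fun h => h.2
    have h2 : ¬ Incomp r d j := hd.elim (fun h h' => h'.1 (_root_.trans h hij)) fun h h' => h'.1 h.1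
    rw [map_add, map_sub, classSum_single, classSum_single, if_neg h1, if_neg h2]
    simp
  have hneg : ∀ c, Incomp r c i →
      classSum r c (β + (Finsupp.single j 1 - Finsupp.single i 1)) = classSum r c β - 1 := by
    intro c hc
    have : ¬ Incomp r c j := fun h' => h'.1 (hadm.lt_of_incomp_of_lt hc hij)
    rw [map_add, map_sub, classSum_single, classSum_single, if_pos hc, if_neg this]
    ring
  rcases h with ⟨c, hc, hd⟩ | h0
  · by_cases h1 : r i c
    · refine ⟨i, ?_, fun d hdi => ?_⟩
      · rw [hneg i (incomp_self r i), hd i h1]; simp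
      · rw [key d (Or.inl hdi), hd d (_root_.trans hdi h1)]
    · by_cases h2 : r c i
      · refine ⟨c, ?_, fun d hdc => ?_⟩
        · rwa [key c (Or.inl h2)]
        · rw [key d (Or.inl (_root_.trans hdc h2)), hd d hdc]
      · have hci : Incomp r c i := ⟨h2, h1⟩
        refine ⟨c, ?_, fun d hdc => ?_⟩
        · rw [hneg c hci]; omega
        · rw [key d (Or.inl (hadm.lt_of_lt_of_incomp hdc hci)), hd d hdc]
  · refine ⟨i, ?_, fun d hdi => ?_⟩
    · rw [hneg i (incomp_self r i), h0]; simp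
    · rw [key d (Or.inl hdi), h0]

theorem LowWord.isNegWeight {r : ℕ+ → ℕ+ → Prop} [IsStrictOrder ℕ+ r]
    (hadm : IsAdmissible r) {v m : M} {β : ℕ+ →₀ ℤ} (h : LowWord r v β m) :
    IsNegWeight r β := by
  induction h with
  | base i j h hm => exact IsNegWeight.add hadm h (Or.inr (hm.classSum_eq_zero hadm))
  | step i j h _ ih => exact IsNegWeight.add hadm h (Or.inl ih)

/-- `v` is a weight vector. -/
def IsWeightVector (v : M) : Prop := ∃ ν : ℕ+ → ℕ+ → ℂ, ∀ i j, ⁅cartanVec i j, v⁆ = ν i j • v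

theorem lie_cartanVec_step {m : M} {β : ℕ+ →₀ ℤ} {ν : ℕ+ → ℕ+ → ℂ} (a b : ℕ+)
    (h : ∀ i j, ⁅cartanVec i j, m⁆ = (ν i j + (β i - β j)) • m) (i j : ℕ+) :
    ⁅cartanVec i j, ⁅rootVec a b, m⁆⁆ =
      (ν i j + (((β + (Finsupp.single a 1 - Finsupp.single b 1) : ℕ+ →₀ ℤ) i : ℂ) -
        ((β + (Finsupp.single a 1 - Finsupp.single b 1) : ℕ+ →₀ ℤ) j : ℂ))) • ⁅rootVec a b, m⁆ := by
  rw [leibniz_lie, cartanVec_lie_rootVec, h, smul_lie, lie_smul, ← add_smul]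
  congr 1
  rw [Finsupp.add_apply, Finsupp.add_apply]
  push_cast
  ring

theorem LeviWord.lie_cartanVec {r : ℕ+ → ℕ+ → Prop} {v m : M} {β : ℕ+ →₀ ℤ}
    {ν : ℕ+ → ℕ+ → ℂ} (hν : ∀ i j, ⁅cartanVec i j, v⁆ = ν i j • v)
    (h : LeviWord r v β m) (i j : ℕ+) :
    ⁅cartanVec i j, m⁆ = (ν i j + (β i - β j)) • m := by
  induction h generalizing i j with
  | base => simpa using hν i j
  | step a b _ _ ih => exact lie_cartanVec_step a b ih i j

theorem LowWord.lie_cartanVec {r : ℕ+ → ℕ+ → Prop} {v m : M} {β : ℕ+ →₀ ℤ}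
    {ν : ℕ+ → ℕ+ → ℂ} (hν : ∀ i j, ⁅cartanVec i j, v⁆ = ν i j • v)
    (h : LowWord r v β m) (i j : ℕ+) :
    ⁅cartanVec i j, m⁆ = (ν i j + (β i - β j)) • m := by
  induction h generalizing i j with
  | base a b _ hm => exact lie_cartanVec_step b a (hm.lie_cartanVec hν) i j
  | step a b _ _ ih => exact lie_cartanVec_step b a ih i j

theorem LeviWord.isWeightVector {r : ℕ+ → ℕ+ → Prop} {v m : M} {β : ℕ+ →₀ ℤ}
    (hv : IsWeightVector v) (h : LeviWord r v β m) : IsWeightVector m := by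
  obtain ⟨ν, hν⟩ := hv
  exact ⟨_, h.lie_cartanVec hν⟩

-- The `cartanVec`s commute, so their simultaneous generalized eigenspaces are independent in any
-- module; no weight decomposition of `M` is needed.
variable (M) in
theorem iSupIndep_cartanVec : iSupIndep fun χ : ℕ+ × ℕ+ → ℂ =>
    ⨅ q : ℕ+ × ℕ+, (LieModule.toEnd ℂ slInf M (cartanVec q.1 q.2)).maxGenEigenspace (χ q) := by
  refine Module.End.independent_iInf_maxGenEigenspace_of_forall_mapsTo _ fun p q φ =>
    Module.End.mapsTo_maxGenEigenspace_of_comm (LinearMap.ext fun m => ?_) φ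
  have := leibniz_lie (cartanVec p.1 p.2) (cartanVec q.1 q.2) m
  rw [cartanVec_lie_cartanVec, zero_lie, zero_add] at this
  exact this.symm

/-- Both spans consist of sums of weight vectors, but the two sets of weights, zero class sums
against `IsNegWeight`, are disjoint. -/
theorem disjoint_leviSpan_lowSpan {r : ℕ+ → ℕ+ → Prop} [IsStrictOrder ℕ+ r]
    (hadm : IsAdmissible r) {v : M} (hv : IsWeightVector v) :
    Disjoint (leviSpan r v) (lowSpan r v) := by
  obtain ⟨ν, hν⟩ := hv
  let χ : (ℕ+ →₀ ℤ) → ℕ+ × ℕ+ → ℂ := fun β q => ν q.1 q.2 + (β q.1 - β q.2)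
  have hχ : Function.Injective χ := by
    intro β β' h
    have h' : ∀ i j, β i - β j = β' i - β' j := by
      intro i j
      have := congrFun h (i, j)
      simp only [χ, add_right_inj] at this
      exact_mod_cast this
    -- The Cartan subalgebra sees only differences of coefficients; comparing with an index outside
    -- both finite supports fixes the additive constant.
    obtain ⟨j, hj⟩ := Infinite.exists_notMem_finset (β.support ∪ β'.support)
    simp only [Finset.mem_union, Finsupp.mem_support_iff, not_or, not_not] at hj
    ext i
    simpa [hj.1, hj.2] using h' i j
  have hmem : ∀ (β : ℕ+ →₀ ℤ) (m : M),
      (∀ i j, ⁅cartanVec i j, m⁆ = (ν i j + (β i - β j)) • m) →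
      m ∈ ⨅ q : ℕ+ × ℕ+,
        (LieModule.toEnd ℂ slInf M (cartanVec q.1 q.2)).maxGenEigenspace (χ β q) := by
    intro β m h
    refine Submodule.mem_iInf _ |>.2 fun q => ?_
    exact (Module.End.mem_maxGenEigenspace _ _ _).2 ⟨1, by simp [h, χ]⟩
  refine ((iSupIndep_cartanVec M).disjoint_biSup_biSup
    (s := χ '' {β | ∀ c, classSum r c β = 0}) (t := χ '' {β | IsNegWeight r β}) ?_).mono ?_ ?_
  · rw [Set.disjoint_image_iff hχ, Set.disjoint_left]
    rintro β h0 ⟨c, hc, -⟩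
    exact hc.ne (h0 c)
  · refine Submodule.span_le.2 ?_
    rintro m ⟨β, h⟩
    exact Submodule.mem_iSup_of_mem (χ β) (Submodule.mem_iSup_of_mem
      ⟨β, h.classSum_eq_zero hadm, rfl⟩ (hmem β m (h.lie_cartanVec hν)))
  · refine Submodule.span_le.2 ?_
    rintro m ⟨β, h⟩
    exact Submodule.mem_iSup_of_mem (χ β) (Submodule.mem_iSup_of_mem
      ⟨β, h.isNegWeight hadm, rfl⟩ (hmem β m (h.lie_cartanVec hν)))

/-- The radical is normalized by the Levi component: by admissibility, bracketing `E_{ij}` with `i ≺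
j` and a Levi root vector gives only root vectors of the same kind. -/
theorem lie_leviSpan_eq_zero {r : ℕ+ → ℕ+ → Prop} [IsStrictOrder ℕ+ r] (hadm : IsAdmissible r)
    {v : M} (hv : ∀ i j, r i j → ⁅rootVec i j, v⁆ = 0) {i j : ℕ+} (hij : r i j) {m : M}
    (hm : m ∈ leviSpan r v) : ⁅rootVec i j, m⁆ = 0 := by
  -- The commutators involve other raising operators, so the induction must carry the vanishing for
  -- all of them at once.
  suffices h : leviSpan r v ≤ ⨅ q : {q : ℕ+ × ℕ+ // r q.1 q.2},
      LinearMap.ker (LieModule.toEnd ℂ slInf M (rootVec q.1.1 q.1.2)) from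
    Submodule.mem_iInf _ |>.1 (h hm) ⟨(i, j), hij⟩
  refine leviSpan_le ?_ ?_
  · exact Submodule.mem_iInf _ |>.2 fun q => hv _ _ q.2
  · intro a b hab m hm
    have hm' : ∀ i j, r i j → ⁅rootVec i j, m⁆ = 0 := fun i j h =>
      Submodule.mem_iInf _ |>.1 hm ⟨(i, j), h⟩
    refine Submodule.mem_iInf _ |>.2 fun ⟨⟨i, j⟩, hij⟩ => ?_
    change ⁅rootVec i j, ⁅rootVec a b, m⁆⁆ = 0
    by_cases hab' : a = b
    · subst hab'; simp [rootVec_self]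
    have hij' : r i j := hij
    rw [leibniz_lie, hm' i j hij', lie_zero, add_zero, rootVec_lie_rootVec (ne_of_irrefl hij') hab']
    · rw [sub_lie]
      split_ifs with h1 h2 h2
      · rw [hm' i b, hm' a j, sub_zero]
        · exact (hab.2 (h1 ▸ h2 ▸ hij')).elim
        · exact hadm.lt_of_lt_of_incomp hij' (h1 ▸ hab)
      · rw [hm' i b, zero_lie, sub_zero]
        exact hadm.lt_of_lt_of_incomp hij' (h1 ▸ hab)
      · rw [hm' a j, zero_lie, sub_zero]
        exact hadm.lt_of_incomp_of_lt (h2 ▸ hab) hij'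
      · simp
    · rintro ⟨rfl, rfl⟩
      exact hab.2 hij'

/-- Vectors obtained from `T` by applying at least one root vector `E_{ji}` with `i ≺ j`. -/
inductive Lowered (r : ℕ+ → ℕ+ → Prop) (T : Submodule ℂ M) : M → Prop
  | base {m} (i j : ℕ+) (h : r i j) (hm : m ∈ T) : Lowered r T ⁅rootVec j i, m⁆
  | step {m} (i j : ℕ+) (h : r i j) (hm : Lowered r T m) : Lowered r T ⁅rootVec j i, m⁆

/-- The span of the vectors obtained from `T` by applying root vectors `E_{ji}` with `i ≺ j`. -/
def lowHull (r : ℕ+ → ℕ+ → Prop) (T : Submodule ℂ M) : Submodule ℂ M :=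
  Submodule.span ℂ {m | Lowered r T m}

theorem lowHull_le {r : ℕ+ → ℕ+ → Prop} {T T' : Submodule ℂ M}
    (hbase : ∀ i j, r i j → ∀ m ∈ T, ⁅rootVec j i, m⁆ ∈ T')
    (hT : ∀ i j, r i j → ∀ m ∈ T', ⁅rootVec j i, m⁆ ∈ T') : lowHull r T ≤ T' := by
  refine Submodule.span_le.2 ?_
  intro m hm
  induction hm with
  | base i j h hm => exact hbase i j h _ hm
  | step i j h _ ih => exact hT i j h _ ih

theorem lie_mem_lowHull_of_mem {r : ℕ+ → ℕ+ → Prop} {T : Submodule ℂ M} {m : M} {i j : ℕ+}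
    (h : r i j) (hm : m ∈ T) : ⁅rootVec j i, m⁆ ∈ lowHull r T :=
  Submodule.subset_span (.base i j h hm)

theorem lie_mem_lowHull {r : ℕ+ → ℕ+ → Prop} {T : Submodule ℂ M} {m : M} {i j : ℕ+}
    (h : r i j) (hm : m ∈ lowHull r T) : ⁅rootVec j i, m⁆ ∈ lowHull r T :=
  span_stable _ (fun _ hβ => Submodule.subset_span (Lowered.step i j h hβ)) hm

theorem lowHull_mono {r : ℕ+ → ℕ+ → Prop} {T T' : Submodule ℂ M} (h : T ≤ T') :
    lowHull r T ≤ lowHull r T' :=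
  lowHull_le (fun _ _ hij _ hm => lie_mem_lowHull_of_mem hij (h hm))
    fun _ _ hij _ hm => lie_mem_lowHull hij hm

theorem disjoint_leviSpan_lowHull {r : ℕ+ → ℕ+ → Prop} [IsStrictOrder ℕ+ r]
    (hadm : IsAdmissible r) {v : M} (hv : IsWeightVector v) :
    Disjoint (leviSpan r v) (lowHull r (leviSpan r v)) :=
  (disjoint_leviSpan_lowSpan hadm hv).mono_right
    (lowHull_le (fun _ _ h _ hm => lie_mem_lowSpan_of_leviSpan h hm)
      fun _ _ h _ hm => lie_mem_lowSpan h hm)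

/-- An operator `x` is moved past the leftmost letter of a lowering word by the Leibniz rule, until
it meets an element of `T`, where every root vector either stays in `T`, vanishes, or lowers. -/
theorem lie_mem_sup_lowHull {r : ℕ+ → ℕ+ → Prop} {T : Submodule ℂ M}
    (hlevi : ∀ i j, Incomp r i j → ∀ m ∈ T, ⁅rootVec i j, m⁆ ∈ T)
    (hcartan : ∀ i j, ∀ m ∈ T, ⁅cartanVec i j, m⁆ ∈ T)
    (hraise : ∀ i j, r i j → ∀ m ∈ T, ⁅rootVec i j, m⁆ = 0) (x : slInf) {m : M}
    (hm : m ∈ T ⊔ lowHull r T) : ⁅x, m⁆ ∈ T ⊔ lowHull r T := by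
  set T' := T ⊔ lowHull r T with hT'
  have hlow : ∀ i j, r i j → ∀ m ∈ T', ⁅rootVec j i, m⁆ ∈ T' := by
    intro i j hij m hm
    obtain ⟨a, ha, b, hb, rfl⟩ := Submodule.mem_sup.1 hm
    rw [lie_add]
    exact T'.add_mem (le_sup_right (a := T) (lie_mem_lowHull_of_mem hij ha))
      (le_sup_right (a := T) (lie_mem_lowHull hij hb))
  have hbase : ∀ x : slInf, ∀ m ∈ T, ⁅x, m⁆ ∈ T' := by
    intro x
    induction x using slInf_induction with
    | zero => simp
    | add x y hx hy =>
      intro m hm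
      rw [add_lie]
      exact T'.add_mem (hx m hm) (hy m hm)
    | smul c x hx =>
      intro m hm
      rw [smul_lie]
      exact T'.smul_mem c (hx m hm)
    | root i j hij =>
      intro m hm
      by_cases h1 : r i j
      · rw [hraise i j h1 m hm]
        exact T'.zero_mem
      · by_cases h2 : r j i
        · exact hlow j i h2 m (le_sup_left (a := T) hm)
        · exact le_sup_left (a := T) (hlevi i j ⟨h1, h2⟩ m hm)
    | cartan i j => exact fun m hm => le_sup_left (a := T) (hcartan i j m hm)
  -- All `x` are treated together because the Leibniz rule replaces `x` by its bracket with a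
  -- lowering operator.
  have hword : ∀ m, Lowered r T m → ∀ x : slInf, ⁅x, m⁆ ∈ T' := by
    intro m h
    induction h with
    | base i j h hm =>
      intro x
      rw [leibniz_lie]
      exact T'.add_mem (hbase _ _ hm) (hlow _ _ h _ (hbase _ _ hm))
    | step i j h _ ih =>
      intro x
      rw [leibniz_lie]
      exact T'.add_mem (ih _) (hlow _ _ h _ (ih _))
  have hlow' : ∀ m ∈ lowHull r T, ⁅x, m⁆ ∈ T' := by
    intro m hm
    rw [← Submodule.span_eq T']
    refine span_stable x ?_ hm
    intro m hm
    rw [Submodule.span_eq T']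
    exact hword m hm x
  obtain ⟨a, ha, b, hb, rfl⟩ := Submodule.mem_sup.1 hm
  rw [lie_add]
  exact T'.add_mem (hbase x a ha) (hlow' b hb)

theorem lie_cartanVec_mem_leviSpan {r : ℕ+ → ℕ+ → Prop} {v m : M} (hv : IsWeightVector v)
    (i j : ℕ+) (hm : m ∈ leviSpan r v) : ⁅cartanVec i j, m⁆ ∈ leviSpan r v := by
  obtain ⟨ν, hν⟩ := hv
  refine span_stable _ ?_ hm
  rintro m ⟨β, hβ⟩
  rw [hβ.lie_cartanVec hν]
  exact Submodule.smul_mem _ _ (Submodule.subset_span ⟨β, hβ⟩)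

theorem lie_mem_leviSpan_sup_lowHull {r : ℕ+ → ℕ+ → Prop} [IsStrictOrder ℕ+ r]
    (hadm : IsAdmissible r) {v : M} (hwt : IsWeightVector v)
    (hv : ∀ i j, r i j → ⁅rootVec i j, v⁆ = 0) (x : slInf) {m : M}
    (hm : m ∈ leviSpan r v ⊔ lowHull r (leviSpan r v)) :
    ⁅x, m⁆ ∈ leviSpan r v ⊔ lowHull r (leviSpan r v) :=
  lie_mem_sup_lowHull (fun _ _ h _ hm => lie_mem_leviSpan h hm)
    (fun i j _ hm => lie_cartanVec_mem_leviSpan hwt i j hm)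
    (fun _ _ h _ hm => lie_leviSpan_eq_zero hadm hv h hm) x hm

theorem sup_lowHull_eq_top [LieModule.IsIrreducible ℂ slInf M] {r : ℕ+ → ℕ+ → Prop}
    {T : Submodule ℂ M}
    (hlevi : ∀ i j, Incomp r i j → ∀ m ∈ T, ⁅rootVec i j, m⁆ ∈ T)
    (hcartan : ∀ i j, ∀ m ∈ T, ⁅cartanVec i j, m⁆ ∈ T)
    (hraise : ∀ i j, r i j → ∀ m ∈ T, ⁅rootVec i j, m⁆ = 0) (hT : T ≠ ⊥) :
    T ⊔ lowHull r T = ⊤ := by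
  let P : LieSubmodule ℂ slInf M :=
    { T ⊔ lowHull r T with
      lie_mem := fun {x _} hm => lie_mem_sup_lowHull hlevi hcartan hraise x hm }
  have hP : P = ⊤ := by
    refine (IsSimpleOrder.eq_bot_or_eq_top P).resolve_left fun h => hT ?_
    rw [eq_bot_iff]
    intro m hm
    have : m ∈ P := le_sup_left (a := T) hm
    rw [h] at this
    exact this
  rw [eq_top_iff]
  intro m _
  exact (hP ▸ LieSubmodule.mem_top m : m ∈ P)

section Maps

variable {M' : Type*} [AddCommGroup M'] [Module ℂ M'] [LieRingModule slInf M']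
  [LieModule ℂ slInf M'] (f : M →ₗ[ℂ] M')

theorem leviSpan_le_comap (hf : ∀ (x : slInf) m, f ⁅x, m⁆ = ⁅x, f m⁆) (r : ℕ+ → ℕ+ → Prop)
    (v : M) : leviSpan r v ≤ (leviSpan r (f v)).comap f := by
  refine leviSpan_le (self_mem_leviSpan r (f v)) fun i j h m hm => ?_
  rw [Submodule.mem_comap, hf]
  exact lie_mem_leviSpan h hm

theorem lowHull_le_comap (hf : ∀ (x : slInf) m, f ⁅x, m⁆ = ⁅x, f m⁆) {r : ℕ+ → ℕ+ → Prop}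
    {T : Submodule ℂ M} {T' : Submodule ℂ M'} (hT : T ≤ T'.comap f) :
    lowHull r T ≤ (lowHull r T').comap f := by
  refine lowHull_le (fun i j h m hm => ?_) fun i j h m hm => ?_
  · rw [Submodule.mem_comap, hf]
    exact lie_mem_lowHull_of_mem h (hT hm)
  · rw [Submodule.mem_comap, hf]
    exact lie_mem_lowHull h hm

end Maps

end Words

/-! ### Induced modules over the enveloping algebra -/

section Aligned

universe u v

variable {L : Type v} [LieRing L] [LieAlgebra ℂ L]

theorem induced_smul (p : LieSubalgebra ℂ L) (S : Type u) [AddCommGroup S] [Module ℂ S]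
    [LieRingModule p S] [LieModule ℂ p S] (x : p) (s : S) :
    UniversalEnvelopingAlgebra.ι ℂ (x : L) •
        (Submodule.Quotient.mk (1 ⊗ₜ[ℂ] s) : InducedModule p S) =
      Submodule.Quotient.mk (1 ⊗ₜ[ℂ] ⁅x, s⁆) := by
  rw [← Submodule.Quotient.mk_smul, Submodule.Quotient.eq]
  refine Submodule.subset_span ⟨1, x, s, ?_⟩
  rw [TensorProduct.smul_tmul', smul_eq_mul, mul_one, one_mul]

theorem eq_top_of_forall_one_tmul_mem {p : LieSubalgebra ℂ L} {S : Type u} [AddCommGroup S]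
    [Module ℂ S] [LieRingModule p S] [LieModule ℂ p S]
    {N : Submodule (UniversalEnvelopingAlgebra ℂ L) (InducedModule p S)}
    (h : ∀ s : S, Submodule.Quotient.mk (1 ⊗ₜ[ℂ] s) ∈ N) : N = ⊤ := by
  rw [eq_top_iff]
  intro q _
  obtain ⟨t, rfl⟩ := Submodule.Quotient.mk_surjective _ q
  induction t using TensorProduct.induction_on with
  | zero => exact N.zero_mem
  | add a b ha hb => exact N.add_mem (ha trivial) (hb trivial)
  | tmul a s =>
    have : (Submodule.Quotient.mk (a ⊗ₜ[ℂ] s) : InducedModule p S) =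
        a • Submodule.Quotient.mk (1 ⊗ₜ[ℂ] s) := by
      rw [← Submodule.Quotient.mk_smul, TensorProduct.smul_tmul', smul_eq_mul, mul_one]
    rw [this]
    exact N.smul_mem a (h s)

/-- A `p`-aligned module has a nonzero vector that is killed by the nilradical. -/
theorem IsAligned.exists_ne_zero {H p l n : LieSubalgebra ℂ L} (hn : n ≤ p) {M : Type u}
    [AddCommGroup M] [Module ℂ M] [LieRingModule L M] [LieModule ℂ L M]
    (h : IsAligned H p l n M) : ∃ v : M, v ≠ 0 ∧ ∀ x ∈ n, ⁅x, v⁆ = 0 := by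
  obtain ⟨-, -, S, _, _, _, _, -, -, hS, N, hN, -, φ, hφ⟩ := h
  have hex : ∃ s : S, (Submodule.Quotient.mk (1 ⊗ₜ[ℂ] s) : InducedModule p S) ∉ N := by
    by_contra! hall
    exact hN.1 (eq_top_of_forall_one_tmul_mem hall)
  obtain ⟨s, hs⟩ := hex
  refine ⟨φ (Submodule.Quotient.mk (Submodule.Quotient.mk (1 ⊗ₜ[ℂ] s))), fun h0 => hs ?_,
    fun x hx => ?_⟩
  · rwa [LinearEquiv.map_eq_zero_iff, Submodule.Quotient.mk_eq_zero] at h0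
  · rw [← hφ, ← Submodule.Quotient.mk_smul, induced_smul p S ⟨x, hn hx⟩ s, hS _ hx,
      TensorProduct.tmul_zero]
    simp

/-- For `m ≠ 0` the eigenvalue of `x` on `m` is unique, hence automatically linear in `x`, and so
defines a weight. -/
theorem mem_iSup_wtSpace {H : LieSubalgebra ℂ L} {M : Type u} [AddCommGroup M] [Module ℂ M]
    [LieRingModule L M] [LieModule ℂ L M] {m : M} (h : ∀ x ∈ H, ∃ c : ℂ, ⁅x, m⁆ = c • m) :
    m ∈ ⨆ ν : Module.Dual ℂ H, wtSpace H M ν := by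
  by_cases hm : m = 0
  · subst hm; exact Submodule.zero_mem _
  choose c hc using fun x : H => h x x.2
  have hinj : ∀ a b : ℂ, a • m = b • m → a = b := fun a b hab => smul_left_injective ℂ hm hab
  let ν : Module.Dual ℂ H :=
    { toFun := c
      map_add' := fun x y => hinj _ _ (by
        rw [← hc, add_smul, ← hc, ← hc, ← add_lie]; rfl)
      map_smul' := fun d x => hinj _ _ (by
        rw [← hc, RingHom.id_apply, smul_assoc, ← hc, ← smul_lie]; rfl) }
  exact Submodule.mem_iSup_of_mem ν hc

/-- The enveloping algebra is a quotient of the tensor algebra, so it suffices to follow scalars,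
generators, products and sums. -/
theorem mem_of_ι_stable {Q : Type*} [AddCommGroup Q] [Module ℂ Q]
    [Module (UniversalEnvelopingAlgebra ℂ L) Q] [IsScalarTower ℂ (UniversalEnvelopingAlgebra ℂ L) Q]
    (T : Submodule ℂ Q) (h : ∀ (x : L), ∀ m ∈ T, UniversalEnvelopingAlgebra.ι ℂ x • m ∈ T)
    (a : UniversalEnvelopingAlgebra ℂ L) : ∀ m ∈ T, a • m ∈ T := by
  obtain ⟨t, rfl⟩ : ∃ t, UniversalEnvelopingAlgebra.mkAlgHom ℂ L t = a :=
    RingCon.mkₐ_surjective _ a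
  induction t using TensorAlgebra.induction with
  | algebraMap c =>
    intro m hm
    rw [AlgHom.commutes, algebraMap_smul]
    exact T.smul_mem c hm
  | ι x => exact h x
  | mul a b ha hb =>
    intro m hm
    rw [map_mul, mul_smul]
    exact ha _ (hb _ hm)
  | add a b ha hb =>
    intro m hm
    rw [map_add, add_smul]
    exact T.add_mem (ha _ hm) (hb _ hm)

/-- A subspace that is stable under the Lie algebra, as a module over the enveloping algebra. -/
def ofStable {Q : Type*} [AddCommGroup Q] [Module ℂ Q]
    [Module (UniversalEnvelopingAlgebra ℂ L) Q] [IsScalarTower ℂ (UniversalEnvelopingAlgebra ℂ L) Q]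
    (T : Submodule ℂ Q) (h : ∀ (x : L), ∀ m ∈ T, UniversalEnvelopingAlgebra.ι ℂ x • m ∈ T) :
    Submodule (UniversalEnvelopingAlgebra ℂ L) Q :=
  { T with smul_mem' := fun a _ hm => mem_of_ι_stable T h a _ hm }

section

attribute [local instance] LieRing.ofAssociativeRing

/-- A module over the enveloping algebra is a Lie ring module. -/
@[reducible]
noncomputable def envLieRingModule (Q : Type*) [AddCommGroup Q]
    [Module (UniversalEnvelopingAlgebra ℂ L) Q] : LieRingModule L Q where
  bracket x q := UniversalEnvelopingAlgebra.ι ℂ x • q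
  add_lie x y q := by
    rw [map_add, add_smul]
  lie_add x q q' := smul_add _ _ _
  leibniz_lie x y q := by
    change _ • _ • q = UniversalEnvelopingAlgebra.ι ℂ ⁅x, y⁆ • q + _ • _ • q
    rw [LieHom.map_lie, LieRing.of_associative_ring_bracket, sub_smul, mul_smul, mul_smul]
    abel

theorem envLieModule (Q : Type*) [AddCommGroup Q] [Module ℂ Q]
    [Module (UniversalEnvelopingAlgebra ℂ L) Q]
    [IsScalarTower ℂ (UniversalEnvelopingAlgebra ℂ L) Q] :
    letI := envLieRingModule (L := L) Q
    LieModule ℂ L Q :=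
  letI := envLieRingModule (L := L) Q
  { smul_lie := fun c x q => by
      change UniversalEnvelopingAlgebra.ι ℂ (c • x) • q = c • _ • q
      rw [map_smul, smul_assoc]
    lie_smul := fun c x q => by
      change UniversalEnvelopingAlgebra.ι ℂ x • c • q = c • _ • q
      rw [smul_comm] }

end

/-- The action of the enveloping algebra on a Lie module. -/
@[reducible]
noncomputable def envModule (M : Type*) [AddCommGroup M] [Module ℂ M] [LieRingModule L M]
    [LieModule ℂ L M] : Module (UniversalEnvelopingAlgebra ℂ L) M :=
  Module.compHom M (UniversalEnvelopingAlgebra.lift ℂ (LieModule.toEnd ℂ L M)).toRingHom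

theorem envModule_smul (M : Type*) [AddCommGroup M] [Module ℂ M] [LieRingModule L M]
    [LieModule ℂ L M] (x : L) (m : M) :
    letI := envModule (L := L) M
    UniversalEnvelopingAlgebra.ι ℂ x • m = ⁅x, m⁆ := by
  change (UniversalEnvelopingAlgebra.lift ℂ (LieModule.toEnd ℂ L M))
    (UniversalEnvelopingAlgebra.ι ℂ x) m = _
  rw [UniversalEnvelopingAlgebra.lift_ι_apply]
  rfl

theorem envModule_isScalarTower (M : Type*) [AddCommGroup M] [Module ℂ M] [LieRingModule L M]
    [LieModule ℂ L M] :
    letI := envModule (L := L) M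
    IsScalarTower ℂ (UniversalEnvelopingAlgebra ℂ L) M :=
  letI := envModule (L := L) M
  ⟨fun c a m => by
    change (UniversalEnvelopingAlgebra.lift ℂ (LieModule.toEnd ℂ L M)) (c • a) m =
      c • (UniversalEnvelopingAlgebra.lift ℂ (LieModule.toEnd ℂ L M)) a m
    rw [map_smul]
    rfl⟩

noncomputable instance (p : LieSubalgebra ℂ L) (S : Type*) [AddCommGroup S] [Module ℂ S]
    [LieRingModule p S] [LieModule ℂ p S] : LieRingModule L (InducedModule p S) :=
  envLieRingModule _

instance (p : LieSubalgebra ℂ L) (S : Type*) [AddCommGroup S] [Module ℂ S]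
    [LieRingModule p S] [LieModule ℂ p S] : LieModule ℂ L (InducedModule p S) :=
  envLieModule _

/-- The canonical map `S → U(L) ⊗_{U(p)} S`. -/
noncomputable def inducedIncl (p : LieSubalgebra ℂ L) (S : Type*) [AddCommGroup S] [Module ℂ S]
    [LieRingModule p S] [LieModule ℂ p S] : S →ₗ[ℂ] InducedModule p S :=
  ((Submodule.mkQ (inducedRel p S)).restrictScalars ℂ) ∘ₗ
    TensorProduct.mk ℂ (UniversalEnvelopingAlgebra ℂ L) S 1

theorem lie_inducedIncl {p : LieSubalgebra ℂ L} {S : Type*} [AddCommGroup S] [Module ℂ S]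
    [LieRingModule p S] [LieModule ℂ p S] (x : p) (s : S) :
    ⁅(x : L), inducedIncl p S s⁆ = inducedIncl p S ⁅x, s⁆ :=
  induced_smul p S x s

/-- The homomorphism `U(L) ⊗_{U(p)} S → M` extending a homomorphism of `p`-modules. -/
noncomputable def inducedLift {p : LieSubalgebra ℂ L} {S M : Type*} [AddCommGroup S]
    [Module ℂ S] [LieRingModule p S] [LieModule ℂ p S] [AddCommGroup M] [Module ℂ M]
    [Module (UniversalEnvelopingAlgebra ℂ L) M] [IsScalarTower ℂ (UniversalEnvelopingAlgebra ℂ L) M]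
    (f : S →ₗ[ℂ] M) (hf : ∀ (x : p) s, f ⁅x, s⁆ = UniversalEnvelopingAlgebra.ι ℂ (x : L) • f s) :
    InducedModule p S →ₗ[UniversalEnvelopingAlgebra ℂ L] M :=
  Submodule.liftQ _ (TensorProduct.AlgebraTensorModule.lift
    (LinearMap.toSpanSingleton (UniversalEnvelopingAlgebra ℂ L) (S →ₗ[ℂ] M) f)) <| by
      refine Submodule.span_le.2 ?_
      rintro _ ⟨a, x, s, rfl⟩
      simp [hf, mul_smul]

theorem inducedLift_inducedIncl {p : LieSubalgebra ℂ L} {S M : Type*} [AddCommGroup S]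
    [Module ℂ S] [LieRingModule p S] [LieModule ℂ p S] [AddCommGroup M] [Module ℂ M]
    [Module (UniversalEnvelopingAlgebra ℂ L) M] [IsScalarTower ℂ (UniversalEnvelopingAlgebra ℂ L) M]
    (f : S →ₗ[ℂ] M) (hf : ∀ (x : p) s, f ⁅x, s⁆ = UniversalEnvelopingAlgebra.ι ℂ (x : L) • f s)
    (s : S) : inducedLift f hf (inducedIncl p S s) = f s := by
  change TensorProduct.AlgebraTensorModule.lift
    (LinearMap.toSpanSingleton (UniversalEnvelopingAlgebra ℂ L) (S →ₗ[ℂ] M) f) (1 ⊗ₜ[ℂ] s) = _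
  simp

end Aligned

/-! ## A criterion for a simple weight module to be aligned -/

section Criterion

variable {M : Type*} [AddCommGroup M] [Module ℂ M] [LieRingModule slInf M] [LieModule ℂ slInf M]

theorem eq_cartanVec {x : slInf} {i j : ℕ+}
    (h : (x : Module.End ℂ NatRep) = matUnit i i - matUnit j j) : x = cartanVec i j :=
  Subtype.ext h

theorem eq_rootVec {x : slInf} {i j : ℕ+} (hij : i ≠ j)
    (h : (x : Module.End ℂ NatRep) = matUnit i j) : x = rootVec i j :=
  Subtype.ext (h.trans (coe_rootVec hij).symm)

theorem lieSpan_stable {s : Set slInf} {T : Submodule ℂ M} (h : ∀ x ∈ s, ∀ m ∈ T, ⁅x, m⁆ ∈ T)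
    {x : slInf} (hx : x ∈ LieSubalgebra.lieSpan ℂ slInf s) : ∀ m ∈ T, ⁅x, m⁆ ∈ T := by
  induction hx using LieSubalgebra.lieSpan_induction with
  | mem x hx => exact h x hx
  | zero => simp
  | add x y _ _ hx hy =>
    intro m hm
    rw [add_lie]
    exact T.add_mem (hx m hm) (hy m hm)
  | smul c x _ hx =>
    intro m hm
    rw [smul_lie]
    exact T.smul_mem c (hx m hm)
  | lie x y _ _ hx hy =>
    intro m hm
    rw [lie_lie]
    exact T.sub_mem (hx _ (hy m hm)) (hy _ (hx m hm))

theorem lieSpan_lie_eq_zero {s : Set slInf} {m : M} (h : ∀ x ∈ s, ⁅x, m⁆ = 0)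
    {x : slInf} (hx : x ∈ LieSubalgebra.lieSpan ℂ slInf s) : ⁅x, m⁆ = 0 := by
  induction hx using LieSubalgebra.lieSpan_induction with
  | mem x hx => exact h x hx
  | zero => simp
  | add x y _ _ hx hy => rw [add_lie, hx, hy, add_zero]
  | smul c x _ hx => rw [smul_lie, hx, smul_zero]
  | lie x y _ _ hx hy => rw [lie_lie, hx, hy, lie_zero, lie_zero, sub_zero]

theorem slCartan_stable {T : Submodule ℂ M} (h : ∀ i j, ∀ m ∈ T, ⁅cartanVec i j, m⁆ ∈ T)
    {x : slInf} (hx : x ∈ slCartan) : ∀ m ∈ T, ⁅x, m⁆ ∈ T := by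
  refine lieSpan_stable ?_ hx
  rintro x ⟨i, j, hx⟩
  rw [eq_cartanVec hx]
  exact h i j

theorem IsWeightVector.exists_smul {m : M} (h : IsWeightVector m) {x : slInf}
    (hx : x ∈ slCartan) : ∃ c : ℂ, ⁅x, m⁆ = c • m := by
  obtain ⟨ν, hν⟩ := h
  have := slCartan_stable (T := Submodule.span ℂ {m}) (fun i j m' hm' => by
    obtain ⟨c, rfl⟩ := Submodule.mem_span_singleton.1 hm'
    rw [lie_smul, hν]
    exact Submodule.smul_mem _ _ (Submodule.smul_mem _ _ (Submodule.mem_span_singleton_self m)))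
    hx m (Submodule.mem_span_singleton_self m)
  obtain ⟨c, hc⟩ := Submodule.mem_span_singleton.1 this
  exact ⟨c, hc.symm⟩

theorem parabolic_stable {r : ℕ+ → ℕ+ → Prop} {T : Submodule ℂ M}
    (hlevi : ∀ i j, Incomp r i j → ∀ m ∈ T, ⁅rootVec i j, m⁆ ∈ T)
    (hcartan : ∀ i j, ∀ m ∈ T, ⁅cartanVec i j, m⁆ ∈ T)
    (hraise : ∀ i j, r i j → ∀ m ∈ T, ⁅rootVec i j, m⁆ ∈ T)
    {x : slInf} (hx : x ∈ parabolic r) : ∀ m ∈ T, ⁅x, m⁆ ∈ T := by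
  refine lieSpan_stable ?_ hx
  rintro x (hx | ⟨i, j, hij, h, hx⟩)
  · exact slCartan_stable hcartan hx
  · rw [eq_rootVec hij hx]
    exact h.elim (hraise i j) (hlevi i j)

theorem slCartan_le_levi (r : ℕ+ → ℕ+ → Prop) : slCartan ≤ levi r :=
  fun _ hx => LieSubalgebra.subset_lieSpan (Or.inl hx)

theorem rootVec_mem_levi {r : ℕ+ → ℕ+ → Prop} {i j : ℕ+} (h : Incomp r i j) :
    rootVec i j ∈ levi r := by
  by_cases hij : i = j
  · subst hij; rw [rootVec_self]; exact (levi r).zero_mem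
  · exact LieSubalgebra.subset_lieSpan (Or.inr ⟨i, j, hij, h, coe_rootVec hij⟩)

theorem rootVec_mem_nilrad {r : ℕ+ → ℕ+ → Prop} [IsStrictOrder ℕ+ r] {i j : ℕ+} (h : r i j) :
    rootVec i j ∈ nilrad r :=
  LieSubalgebra.subset_lieSpan ⟨i, j, h, coe_rootVec (ne_of_irrefl h)⟩

theorem nilrad_lie_eq_zero {r : ℕ+ → ℕ+ → Prop} [IsStrictOrder ℕ+ r] {m : M}
    (h : ∀ i j, r i j → ⁅rootVec i j, m⁆ = 0) {x : slInf} (hx : x ∈ nilrad r) : ⁅x, m⁆ = 0 := by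
  refine lieSpan_lie_eq_zero ?_ hx
  rintro x ⟨i, j, hij, hx⟩
  rw [eq_rootVec (ne_of_irrefl hij) hx]
  exact h i j hij

/-- The `𝔭(≺)`-submodule generated by a weight vector killed by `𝔲(≺)`. -/
noncomputable def leviSubmodule {r : ℕ+ → ℕ+ → Prop} [IsStrictOrder ℕ+ r] (hadm : IsAdmissible r)
    {v : M} (hwt : IsWeightVector v) (hv : ∀ i j, r i j → ⁅rootVec i j, v⁆ = 0) :
    LieSubmodule ℂ (parabolic r) M :=
  { leviSpan r v with
    lie_mem := fun {x _} hm => parabolic_stable (fun _ _ h _ hm => lie_mem_leviSpan h hm)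
      (fun i j _ hm => lie_cartanVec_mem_leviSpan hwt i j hm)
      (fun _ _ h _ hm => by
        rw [lie_leviSpan_eq_zero hadm hv h hm]; exact Submodule.zero_mem _) x.2 _ hm }

section

variable {r : ℕ+ → ℕ+ → Prop} [IsStrictOrder ℕ+ r] {v : M}

/-- A nonzero Levi submodule `T'` of `leviSpan r v` satisfies `T' + lowHull r T' = M`. Writing `v =
t + y` accordingly, `y = v - t` lies in both `leviSpan r v` and its `lowHull`, so it is `0` and `v ∈
T'`. -/
theorem leviSubmodule_isIrreducible [LieModule.IsIrreducible ℂ slInf M] (hadm : IsAdmissible r)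
    (hwt : IsWeightVector v)
    (hv : ∀ i j, r i j → ⁅rootVec i j, v⁆ = 0) (hv0 : v ≠ 0) :
    LieModule.IsIrreducible ℂ ((levi r).comap (parabolic r).incl)
      (leviSubmodule hadm hwt hv) := by
  have hnt : Nontrivial (leviSubmodule hadm hwt hv) :=
    ⟨⟨⟨v, self_mem_leviSpan r v⟩, 0, fun h => hv0 (congrArg Subtype.val h)⟩⟩
  refine LieModule.IsIrreducible.mk fun T hT => ?_
  set T' : Submodule ℂ M := T.toSubmodule.map (leviSubmodule hadm hwt hv).toSubmodule.subtype
    with hT'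
  have hle : T' ≤ leviSpan r v := by
    rintro _ ⟨t, -, rfl⟩
    exact t.2
  have hstab : ∀ x ∈ levi r, ∀ m ∈ T', ⁅x, m⁆ ∈ T' := by
    rintro x hx _ ⟨t, ht, rfl⟩
    have := T.lie_mem (x := (⟨⟨x, levi_le_parabolic r hx⟩, hx⟩ :
      (levi r).comap (parabolic r).incl)) ht
    exact ⟨_, this, rfl⟩
  have htop := sup_lowHull_eq_top (r := r) (T := T')
    (fun i j h => hstab _ (rootVec_mem_levi h))
    (fun i j => hstab _ (slCartan_le_levi r (cartanVec_mem i j)))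
    (fun i j h m hm => lie_leviSpan_eq_zero hadm hv h (hle hm)) (by
      intro h0
      refine hT ((LieSubmodule.eq_bot_iff _).2 fun t ht => Subtype.ext ?_)
      have : (t : M) ∈ T' := ⟨t, ht, rfl⟩
      rw [h0] at this
      exact this)
  obtain ⟨t, ht, y, hy, hty⟩ := Submodule.mem_sup.1 (htop ▸ Submodule.mem_top : v ∈ _)
  have hy0 : y = 0 := by
    refine Submodule.disjoint_def.1 (disjoint_leviSpan_lowHull hadm hwt) y ?_
      (lowHull_mono hle hy)
    rw [eq_sub_of_add_eq' hty]
    exact Submodule.sub_mem _ (self_mem_leviSpan r v) (hle ht)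
  rw [hy0, add_zero] at hty
  have hvT : leviSpan r v ≤ T' :=
    leviSpan_le (hty ▸ ht) fun i j h => hstab _ (rootVec_mem_levi h)
  rw [eq_top_iff]
  rintro ⟨m, hm⟩ -
  obtain ⟨t, ht, htm⟩ := hvT hm
  have : t = ⟨m, hm⟩ := Subtype.ext htm
  exact this ▸ ht

/-- Levi words in a weight vector are weight vectors, and the weight spaces embed in those of `M`.
-/
theorem leviSubmodule_isWeightModule (hadm : IsAdmissible r) (hwt : IsWeightVector v)
    (hv : ∀ i j, r i j → ⁅rootVec i j, v⁆ = 0)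
    (hM : IsWeightModule slCartan M) :
    IsWeightModule (slCartan.comap (parabolic r).incl) (leviSubmodule hadm hwt hv) := by
  have hle : slCartan ≤ parabolic r := (slCartan_le_levi r).trans (levi_le_parabolic r)
  constructor
  · rw [eq_top_iff]
    rintro ⟨m, hm⟩ -
    have hword : ∀ m' (h : ∃ β, LeviWord r v β m'),
        (⟨m', Submodule.subset_span h⟩ : leviSubmodule hadm hwt hv) ∈
          ⨆ ν, wtSpace (slCartan.comap (parabolic r).incl) (leviSubmodule hadm hwt hv) ν := by
      rintro m' ⟨β, h⟩
      refine mem_iSup_wtSpace fun x hx => ?_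
      obtain ⟨c, hc⟩ := (h.isWeightVector hwt).exists_smul (x := x) hx
      exact ⟨c, Subtype.ext hc⟩
    have key : leviSpan r v ≤ (⨆ ν, wtSpace (slCartan.comap (parabolic r).incl)
        (leviSubmodule hadm hwt hv) ν).map (leviSubmodule hadm hwt hv).toSubmodule.subtype :=
      Submodule.span_le.2 fun m' h => ⟨_, hword m' h, rfl⟩
    obtain ⟨t, ht, htm⟩ := key hm
    have : t = ⟨m, hm⟩ := Subtype.ext htm
    exact this ▸ ht
  · intro ν
    let ν' : Module.Dual ℂ slCartan :=
      { toFun := fun h => ν ⟨⟨h, hle h.2⟩, h.2⟩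
        map_add' := fun x y => by rw [← map_add]; rfl
        map_smul' := fun c x => by rw [RingHom.id_apply, ← map_smul]; rfl }
    have := hM.2 ν'
    refine FiniteDimensional.of_injective (V₂ := wtSpace slCartan M ν')
      (LinearMap.codRestrict _ ((leviSubmodule hadm hwt hv).toSubmodule.subtype ∘ₗ
        (wtSpace (slCartan.comap (parabolic r).incl) (leviSubmodule hadm hwt hv) ν).subtype)
        fun m h => ?_) fun a b hab => ?_
    · exact congrArg Subtype.val (m.2 ⟨⟨h, hle h.2⟩, h.2⟩)
    · exact Subtype.ext (Subtype.ext (congrArg (fun x : wtSpace slCartan M ν' => (x : M)) hab))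

theorem rootVec_mem_parabolic {i j : ℕ+} (h : r i j ∨ Incomp r i j) :
    rootVec i j ∈ parabolic r :=
  h.elim (fun h => nilrad_le_parabolic r (rootVec_mem_nilrad h))
    fun h => levi_le_parabolic r (rootVec_mem_levi h)

theorem cartanVec_mem_parabolic (r : ℕ+ → ℕ+ → Prop) (i j : ℕ+) : cartanVec i j ∈ parabolic r :=
  levi_le_parabolic r (slCartan_le_levi r (cartanVec_mem i j))

/-! ### Uniqueness of the maximal submodule -/

section Quotients

variable {Q : Type*} [AddCommGroup Q] [Module ℂ Q] [LieRingModule slInf Q] [LieModule ℂ slInf Q]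
  [Module (UniversalEnvelopingAlgebra ℂ slInf) Q]
  [IsScalarTower ℂ (UniversalEnvelopingAlgebra ℂ slInf) Q]

/-- In the quotient by `N` the image of `q` equals minus that of `b`. It therefore lies in both
`leviSpan` and its `lowHull` there, and vanishes by disjointness. -/
theorem mem_of_add_mem_of_mem_lowHull (hadm : IsAdmissible r)
    (hQ : ∀ (x : slInf) (q : Q), UniversalEnvelopingAlgebra.ι ℂ x • q = ⁅x, q⁆)
    {q b : Q} (hwt : IsWeightVector q) {N : Submodule (UniversalEnvelopingAlgebra ℂ slInf) Q}
    (hb : b ∈ lowHull r (leviSpan r q)) (hq : q + b ∈ N) : q ∈ N := by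
  let _ := envLieRingModule (L := slInf) (Q ⧸ N)
  have _ := envLieModule (L := slInf) (Q ⧸ N)
  let π : Q →ₗ[ℂ] Q ⧸ N := N.mkQ.restrictScalars ℂ
  have hπ : ∀ (x : slInf) q, π ⁅x, q⁆ = ⁅x, π q⁆ := fun x q => by
    rw [← hQ]
    exact N.mkQ.map_smul _ _
  have hwt' : IsWeightVector (π q) := by
    obtain ⟨ν, hν⟩ := hwt
    exact ⟨ν, fun i j => by rw [← hπ, hν, map_smul]⟩
  have hsum : π q + π b = 0 := by
    rw [← map_add]
    exact (Submodule.Quotient.mk_eq_zero N).2 hq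
  have hπb : π b = 0 := by
    refine Submodule.disjoint_def.1 (disjoint_leviSpan_lowHull hadm hwt') _ ?_
      (lowHull_le_comap π hπ (leviSpan_le_comap π hπ r q) hb)
    rw [eq_neg_of_add_eq_zero_right hsum]
    exact Submodule.neg_mem _ (self_mem_leviSpan r _)
  rw [hπb, add_zero] at hsum
  exact (Submodule.Quotient.mk_eq_zero N).1 hsum

variable [Module (UniversalEnvelopingAlgebra ℂ slInf) M]
  [IsScalarTower ℂ (UniversalEnvelopingAlgebra ℂ slInf) M]

/-- Submodules that are not contained in the kernel map onto a simple module. -/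
theorem exists_mem_map_eq [LieModule.IsIrreducible ℂ slInf M]
    (hM : ∀ (x : slInf) (m : M), UniversalEnvelopingAlgebra.ι ℂ x • m = ⁅x, m⁆)
    (φ : Q →ₗ[UniversalEnvelopingAlgebra ℂ slInf] M)
    {P : Submodule (UniversalEnvelopingAlgebra ℂ slInf) Q} (hP : ¬ P ≤ LinearMap.ker φ) (m : M) :
    ∃ q ∈ P, φ q = m := by
  let P' : LieSubmodule ℂ slInf M :=
    { (P.map φ).restrictScalars ℂ with
      lie_mem := fun {x m} hm => by
        change ⁅x, m⁆ ∈ P.map φ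
        rw [← hM]
        exact (P.map φ).smul_mem _ hm }
  have hP' : P' = ⊤ := by
    refine (IsSimpleOrder.eq_bot_or_eq_top P').resolve_left fun h => hP fun q hq => ?_
    have : φ q ∈ P' := ⟨q, hq, rfl⟩
    rw [h] at this
    exact this
  exact (hP' ▸ LieSubmodule.mem_top m : m ∈ P')

theorem ker_isCoatom [LieModule.IsIrreducible ℂ slInf M]
    (hM : ∀ (x : slInf) (m : M), UniversalEnvelopingAlgebra.ι ℂ x • m = ⁅x, m⁆)
    (φ : Q →ₗ[UniversalEnvelopingAlgebra ℂ slInf] M) (hφ : LinearMap.ker φ ≠ ⊤) :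
    IsCoatom (LinearMap.ker φ) := by
  refine ⟨hφ, fun P hP => ?_⟩
  rw [eq_top_iff]
  intro q _
  obtain ⟨p, hp, hpq⟩ := exists_mem_map_eq hM φ hP.not_ge (φ q)
  have h1 : q - p ∈ P := hP.le (by rw [LinearMap.mem_ker, map_sub, hpq, sub_self])
  simpa using P.add_mem h1 hp

/-- A maximal `N` other than the kernel maps onto `M`, so it contains some `a + b` with the same
image as `q₀`, where `a` is in the Levi part and `b` in the lowered part. Disjointness in `M` forces
`φ b = 0`, hence `a = q₀` by `hinj`; disjointness in the quotient by `N` then gives `q₀ ∈ N`, which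
makes `N` everything. -/
theorem eq_ker_of_isCoatom [LieModule.IsIrreducible ℂ slInf M] (hadm : IsAdmissible r)
    (hM : ∀ (x : slInf) (m : M), UniversalEnvelopingAlgebra.ι ℂ x • m = ⁅x, m⁆)
    (hQ : ∀ (x : slInf) (q : Q), UniversalEnvelopingAlgebra.ι ℂ x • q = ⁅x, q⁆)
    (φ : Q →ₗ[UniversalEnvelopingAlgebra ℂ slInf] M) {q₀ : Q} (hwt : IsWeightVector q₀)
    (htop : ∀ q, q ∈ leviSpan r q₀ ⊔ lowHull r (leviSpan r q₀))
    (hinj : ∀ a ∈ leviSpan r q₀, φ a = φ q₀ → a = q₀)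
    (hgen : ∀ N : Submodule (UniversalEnvelopingAlgebra ℂ slInf) Q, q₀ ∈ N → N = ⊤)
    (hφ : φ q₀ ≠ 0) {N : Submodule (UniversalEnvelopingAlgebra ℂ slInf) Q} (hN : IsCoatom N) :
    N = LinearMap.ker φ := by
  by_contra hne
  have hker : LinearMap.ker φ ≠ ⊤ := fun h => hφ (LinearMap.mem_ker.1 (h ▸ Submodule.mem_top))
  have hnle : ¬ N ≤ LinearMap.ker φ := fun h => hne ((hN.le_iff.1 h).resolve_left hker).symm
  obtain ⟨q, hq, hqv⟩ := exists_mem_map_eq hM φ hnle (φ q₀)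
  obtain ⟨a, ha, b, hb, rfl⟩ := Submodule.mem_sup.1 (htop q)
  let φ' : Q →ₗ[ℂ] M := φ.restrictScalars ℂ
  have hφ' : ∀ (x : slInf) q, φ' ⁅x, q⁆ = ⁅x, φ' q⁆ := fun x q => by
    rw [← hQ, ← hM]
    exact φ.map_smul _ _
  have hwt' : IsWeightVector (φ' q₀) := by
    obtain ⟨ν, hν⟩ := hwt
    exact ⟨ν, fun i j => by rw [← hφ', hν, map_smul]⟩
  have hle := leviSpan_le_comap φ' hφ' r q₀
  have hsum : φ' a + φ' b = φ' q₀ := by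
    rw [← map_add]
    exact hqv
  have hb0 : φ' b = 0 := by
    refine Submodule.disjoint_def.1 (disjoint_leviSpan_lowHull hadm hwt') _ ?_
      (lowHull_le_comap φ' hφ' hle hb)
    rw [eq_sub_of_add_eq' hsum]
    exact Submodule.sub_mem _ (self_mem_leviSpan r _) (hle ha)
  rw [hb0, add_zero] at hsum
  rw [hinj a ha hsum] at hq
  exact hN.1 (hgen N (mem_of_add_mem_of_mem_lowHull hadm hQ hwt hb hq))

end Quotients

/-! ### The induced module as a Levi part plus a lowered part -/

section Induced

variable {S : Type*} [AddCommGroup S] [Module ℂ S] [LieRingModule (parabolic r) S]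
  [LieModule ℂ (parabolic r) S] {s₀ : S}

theorem isWeightVector_inducedIncl {ν : ℕ+ → ℕ+ → ℂ}
    (h : ∀ i j, ⁅(⟨_, cartanVec_mem_parabolic r i j⟩ : parabolic r), s₀⁆ = ν i j • s₀) :
    IsWeightVector (inducedIncl (parabolic r) S s₀) := by
  refine ⟨ν, fun i j => ?_⟩
  rw [← map_smul, ← h]
  exact lie_inducedIncl (p := parabolic r) ⟨_, cartanVec_mem_parabolic r i j⟩ s₀

theorem leviSpan_inducedIncl_le :
    leviSpan r (inducedIncl (parabolic r) S s₀) ≤ LinearMap.range (inducedIncl (parabolic r) S) := by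
  refine leviSpan_le ⟨s₀, rfl⟩ ?_
  rintro i j h _ ⟨s, rfl⟩
  exact ⟨_, (lie_inducedIncl (p := parabolic r) ⟨_, rootVec_mem_parabolic (Or.inr h)⟩ s).symm⟩

theorem inducedIncl_mem_leviSpan
    (hgen : ∀ P : Submodule ℂ S, s₀ ∈ P → (∀ i j (h : Incomp r i j), ∀ s ∈ P,
      ⁅(⟨_, rootVec_mem_parabolic (Or.inr h)⟩ : parabolic r), s⁆ ∈ P) → P = ⊤) (s : S) :
    inducedIncl (parabolic r) S s ∈ leviSpan r (inducedIncl (parabolic r) S s₀) := by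
  have := hgen ((leviSpan r (inducedIncl (parabolic r) S s₀)).comap (inducedIncl (parabolic r) S))
    (self_mem_leviSpan r _) fun i j h s hs => by
      rw [Submodule.mem_comap, ← lie_inducedIncl]
      exact lie_mem_leviSpan h hs
  exact (this ▸ Submodule.mem_top : s ∈ _)

/-- The sum is stable under the enveloping algebra and contains every `1 ⊗ s`, since `s₀` generates
`S` under the Levi root vectors. -/
theorem mem_leviSpan_sup_lowHull_inducedIncl (hadm : IsAdmissible r) {ν : ℕ+ → ℕ+ → ℂ}
    (hwt : ∀ i j, ⁅(⟨_, cartanVec_mem_parabolic r i j⟩ : parabolic r), s₀⁆ = ν i j • s₀)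
    (hv : ∀ i j (h : r i j),
      ⁅(⟨_, rootVec_mem_parabolic (Or.inl h)⟩ : parabolic r), s₀⁆ = 0)
    (hgen : ∀ P : Submodule ℂ S, s₀ ∈ P → (∀ i j (h : Incomp r i j), ∀ s ∈ P,
      ⁅(⟨_, rootVec_mem_parabolic (Or.inr h)⟩ : parabolic r), s⁆ ∈ P) → P = ⊤)
    (q : InducedModule (parabolic r) S) :
    q ∈ leviSpan r (inducedIncl (parabolic r) S s₀) ⊔
      lowHull r (leviSpan r (inducedIncl (parabolic r) S s₀)) := by
  have hv1 : ∀ i j, r i j → ⁅rootVec i j, inducedIncl (parabolic r) S s₀⁆ = 0 := fun i j h =>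
    (lie_inducedIncl (p := parabolic r) ⟨_, rootVec_mem_parabolic (Or.inl h)⟩ s₀).trans
      (by rw [hv i j h, map_zero])
  let P := ofStable (L := slInf) (leviSpan r (inducedIncl (parabolic r) S s₀) ⊔
    lowHull r (leviSpan r (inducedIncl (parabolic r) S s₀))) fun x m hm =>
      lie_mem_leviSpan_sup_lowHull hadm (isWeightVector_inducedIncl hwt) hv1 x hm
  have : P = ⊤ := eq_top_of_forall_one_tmul_mem fun s =>
    le_sup_left (a := leviSpan r (inducedIncl (parabolic r) S s₀))
      (inducedIncl_mem_leviSpan hgen s)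
  exact (this ▸ Submodule.mem_top : q ∈ P)

end Induced

/-- The embedding `f` extends to a surjection from the induced module onto the simple module `M`;
its kernel is the unique maximal submodule. The injectivity needed on the Levi part comes from that
of `f`, because the Levi part lies in the image of `S`. -/
theorem isAligned_of_embedding {M S : Type*} [AddCommGroup M] [Module ℂ M]
    [LieRingModule slInf M] [LieModule ℂ slInf M] [LieModule.IsIrreducible ℂ slInf M]
    [Module (UniversalEnvelopingAlgebra ℂ slInf) M]
    [IsScalarTower ℂ (UniversalEnvelopingAlgebra ℂ slInf) M]
    [AddCommGroup S] [Module ℂ S] [LieRingModule (parabolic r) S] [LieModule ℂ (parabolic r) S]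
    (hadm : IsAdmissible r)
    (hι : ∀ (x : slInf) (m : M), UniversalEnvelopingAlgebra.ι ℂ x • m = ⁅x, m⁆)
    (f : S →ₗ[ℂ] M) (hinj : Function.Injective f)
    (hf : ∀ (x : parabolic r) (s : S), f ⁅x, s⁆ = ⁅(x : slInf), f s⁆)
    {s₀ : S} (hs₀ : s₀ ≠ 0) {ν : ℕ+ → ℕ+ → ℂ}
    (hwt : ∀ i j, ⁅(⟨_, cartanVec_mem_parabolic r i j⟩ : parabolic r), s₀⁆ = ν i j • s₀)
    (hv : ∀ i j (h : r i j),
      ⁅(⟨_, rootVec_mem_parabolic (Or.inl h)⟩ : parabolic r), s₀⁆ = 0)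
    (hgen : ∀ P : Submodule ℂ S, s₀ ∈ P → (∀ i j (h : Incomp r i j), ∀ s ∈ P,
      ⁅(⟨_, rootVec_mem_parabolic (Or.inr h)⟩ : parabolic r), s⁆ ∈ P) → P = ⊤) :
    ∃ N : Submodule (UniversalEnvelopingAlgebra ℂ slInf) (InducedModule (parabolic r) S),
      IsCoatom N ∧ (∀ N', IsCoatom N' → N' = N) ∧
      ∃ φ : (InducedModule (parabolic r) S ⧸ N) ≃ₗ[ℂ] M,
        ∀ (x : slInf) (q : InducedModule (parabolic r) S ⧸ N),
          φ (UniversalEnvelopingAlgebra.ι ℂ x • q) = ⁅x, φ q⁆ := by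
  have hf' : ∀ (x : parabolic r) (s : S), f ⁅x, s⁆ =
      UniversalEnvelopingAlgebra.ι ℂ (x : slInf) • f s := fun x s => by rw [hι, hf]
  have hlift := inducedLift_inducedIncl f hf'
  generalize inducedLift f hf' = φ at hlift
  have hφ : φ (inducedIncl (parabolic r) S s₀) ≠ 0 := by
    rw [hlift, ← map_zero f]
    exact fun h => hs₀ (hinj h)
  have hker : LinearMap.ker φ ≠ ⊤ := fun h => hφ (LinearMap.mem_ker.1 (h ▸ Submodule.mem_top))
  have hinj' : ∀ a ∈ leviSpan r (inducedIncl (parabolic r) S s₀),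
      φ a = φ (inducedIncl (parabolic r) S s₀) → a = inducedIncl (parabolic r) S s₀ := by
    intro a ha h
    obtain ⟨s, rfl⟩ := leviSpan_inducedIncl_le ha
    rw [hlift, hlift] at h
    rw [hinj h]
  have hN : ∀ N : Submodule (UniversalEnvelopingAlgebra ℂ slInf) (InducedModule (parabolic r) S),
      inducedIncl (parabolic r) S s₀ ∈ N → N = ⊤ := by
    intro N hv
    refine eq_top_of_forall_one_tmul_mem fun s => ?_
    have : leviSpan r (inducedIncl (parabolic r) S s₀) ≤ N.restrictScalars ℂ :=
      leviSpan_le hv fun i j _ m hm => N.smul_mem _ hm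
    exact this (inducedIncl_mem_leviSpan hgen s)
  have hsurj : Function.Surjective φ := fun m => by
    obtain ⟨q, -, hq⟩ := exists_mem_map_eq hι φ (P := ⊤) (fun h => hker (top_le_iff.1 h)) m
    exact ⟨q, hq⟩
  refine ⟨LinearMap.ker φ, ker_isCoatom hι φ hker, fun N hN' =>
    eq_ker_of_isCoatom hadm hι (fun _ _ => rfl) φ (isWeightVector_inducedIncl hwt)
      (mem_leviSpan_sup_lowHull_inducedIncl hadm hwt hv hgen) hinj' hN hφ hN',
    (φ.quotKerEquivOfSurjective hsurj).restrictScalars ℂ, fun x q => ?_⟩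
  rw [← hι]
  exact (φ.quotKerEquivOfSurjective hsurj).map_smul _ _

theorem isAligned_of_module [LieModule.IsIrreducible ℂ slInf M]
    [Module (UniversalEnvelopingAlgebra ℂ slInf) M]
    [IsScalarTower ℂ (UniversalEnvelopingAlgebra ℂ slInf) M]
    (hadm : IsAdmissible r) (hwt : IsWeightVector v)
    (hv : ∀ i j, r i j → ⁅rootVec i j, v⁆ = 0)
    (hι : ∀ (x : slInf) (m : M), UniversalEnvelopingAlgebra.ι ℂ x • m = ⁅x, m⁆)
    (hM : IsWeightModule slCartan M) (hv0 : v ≠ 0) :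
    IsAligned slCartan (parabolic r) (levi r) (nilrad r) M := by
  obtain ⟨ν, hν⟩ := id hwt
  refine ⟨inferInstance, hM, leviSubmodule hadm hwt hv, inferInstance, inferInstance,
    inferInstance, inferInstance,
    leviSubmodule_isIrreducible hadm hwt hv hv0, leviSubmodule_isWeightModule hadm hwt hv hM,
    fun x hx s => Subtype.ext (nilrad_lie_eq_zero
      (fun i j h => lie_leviSpan_eq_zero hadm hv h s.2) hx), ?_⟩
  refine isAligned_of_embedding hadm hι (leviSubmodule hadm hwt hv).toSubmodule.subtype
    Subtype.val_injective (fun _ _ => rfl) (s₀ := ⟨v, self_mem_leviSpan r v⟩) (ν := ν)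
    (fun h => hv0 (congrArg Subtype.val h)) (fun i j => Subtype.ext (hν i j))
    (fun i j h => Subtype.ext (hv i j h)) fun P hvP hP => ?_
  have hle : leviSpan r v ≤ P.map (leviSubmodule hadm hwt hv).toSubmodule.subtype := by
    refine leviSpan_le ⟨_, hvP, rfl⟩ ?_
    rintro i j h _ ⟨s, hs, rfl⟩
    exact ⟨_, hP i j h s hs, rfl⟩
  rw [eq_top_iff]
  intro s _
  obtain ⟨t, ht, hts⟩ := hle s.2
  have : t = s := Subtype.ext hts
  exact this ▸ ht

/-- A simple weight module with a nonzero weight vector that is killed by `𝔲(≺)` is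
`𝔭(≺)`-aligned. -/
theorem isAligned_of_weightVector [LieModule.IsIrreducible ℂ slInf M] (hadm : IsAdmissible r)
    (hwt : IsWeightVector v)
    (hv : ∀ i j, r i j → ⁅rootVec i j, v⁆ = 0)
    (hM : IsWeightModule slCartan M) (hv0 : v ≠ 0) :
    IsAligned slCartan (parabolic r) (levi r) (nilrad r) M :=
  letI := envModule (L := slInf) M
  haveI := envModule_isScalarTower (L := slInf) M
  isAligned_of_module hadm hwt hv (envModule_smul (L := slInf) M) hM hv0

end

end Criterion

/-! ## `S^μ V` is a simple weight module -/

section Weights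

variable {M : Type*} [AddCommGroup M] [Module ℂ M] [LieRingModule slInf M] [LieModule ℂ slInf M]

theorem IsWeightVector.lie_rootVec {m : M} (h : IsWeightVector m) (a b : ℕ+) :
    IsWeightVector ⁅rootVec a b, m⁆ := by
  obtain ⟨ν, hν⟩ := h
  exact ⟨_, lie_cartanVec_step (β := 0) a b fun i j => by simpa using hν i j⟩

/-- Weight vectors span a submodule, which is nonzero because of `v` and hence is all of the simple
module. -/
theorem iSup_wtSpace_eq_top [LieModule.IsIrreducible ℂ slInf M] {v : M} (hv : IsWeightVector v)
    (hv0 : v ≠ 0) : (⨆ ν : Module.Dual ℂ slCartan, wtSpace slCartan M ν) = ⊤ := by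
  have hstab : ∀ x : slInf, ∀ m ∈ Submodule.span ℂ {m : M | IsWeightVector m},
      ⁅x, m⁆ ∈ Submodule.span ℂ {m : M | IsWeightVector m} := by
    intro x
    induction x using slInf_induction with
    | zero => simp
    | add x y hx hy =>
      intro m hm
      rw [add_lie]
      exact Submodule.add_mem _ (hx m hm) (hy m hm)
    | smul c x hx =>
      intro m hm
      rw [smul_lie]
      exact Submodule.smul_mem _ c (hx m hm)
    | root i j _ =>
      exact fun m => span_stable _ fun m hm => Submodule.subset_span (hm.lie_rootVec i j)
    | cartan i j =>
      refine fun m => span_stable _ fun m hm => ?_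
      obtain ⟨ν, hν⟩ := id hm
      rw [hν]
      exact Submodule.smul_mem _ _ (Submodule.subset_span hm)
  let P : LieSubmodule ℂ slInf M :=
    { Submodule.span ℂ {m : M | IsWeightVector m} with lie_mem := fun {x m} => hstab x m }
  have hP : P = ⊤ := by
    refine (IsSimpleOrder.eq_bot_or_eq_top P).resolve_left fun h => hv0 ?_
    have : v ∈ P := Submodule.subset_span hv
    rw [h] at this
    exact this
  have hle : Submodule.span ℂ {m : M | IsWeightVector m} ≤
      ⨆ ν : Module.Dual ℂ slCartan, wtSpace slCartan M ν :=
    Submodule.span_le.2 fun m hm => mem_iSup_wtSpace fun x hx => hm.exists_smul hx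
  rw [eq_top_iff]
  intro m _
  exact hle (hP ▸ LieSubmodule.mem_top m : m ∈ P)

end Weights

/-- `E_{aa}` acts as the Euler operator of row `a`, so each monomial is an eigenvector. -/
theorem coeff_symDer_diag (k : ℕ) (a : ℕ+) (p : PolyRep k) (m : ℕ+ × Fin k →₀ ℕ) :
    MvPolynomial.coeff m (symDer k (matUnit a a) p) =
      ((∑ j, m (a, j) : ℕ) : ℂ) * MvPolynomial.coeff m p := by
  rw [symDer_matUnit, MvPolynomial.coeff_sum, Nat.cast_sum, Finset.sum_mul]
  refine Finset.sum_congr rfl fun j _ => ?_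
  rw [MvPolynomial.coeff_X_mul']
  split_ifs with h
  · have h1 : Finsupp.single (a, j) 1 ≤ m := by
      rw [Finsupp.single_le_iff]
      exact Nat.one_le_iff_ne_zero.2 (Finsupp.mem_support_iff.1 h)
    rw [MvPolynomial.coeff_pderiv, tsub_add_cancel_of_le h1, mul_comm]
    congr 1
    have := Finsupp.single_le_iff.1 h1
    rw [Finsupp.tsub_apply, Finsupp.single_eq_same, Nat.cast_sub this]
    simp
  · simp [Finsupp.notMem_support_iff.1 h]

/-- There are finitely many monomials of a given weight. -/
theorem finite_setOf_rowSum_eq (k : ℕ) (m₀ : ℕ+ × Fin k →₀ ℕ) :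
    {m : ℕ+ × Fin k →₀ ℕ | ∀ a, ∑ j, m (a, j) = ∑ j, m₀ (a, j)}.Finite := by
  classical
  let B : ℕ+ × Fin k →₀ ℕ := Finsupp.onFinset
    (m₀.support.image Prod.fst ×ˢ Finset.univ) (fun q => ∑ j, m₀ (q.1, j)) (by
      intro q hq
      obtain ⟨j, -, hj⟩ := Finset.exists_ne_zero_of_sum_ne_zero hq
      exact Finset.mem_product.2 ⟨Finset.mem_image.2
        ⟨(q.1, j), Finsupp.mem_support_iff.2 hj, rfl⟩, Finset.mem_univ _⟩)
  refine (Set.finite_Icc 0 B).subset fun m hm => ⟨fun _ => Nat.zero_le _, fun q => ?_⟩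
  change m q ≤ ∑ j, m₀ (q.1, j)
  rw [← hm q.1]
  exact Finset.single_le_sum (f := fun j => m (q.1, j)) (fun _ _ => Nat.zero_le _)
    (Finset.mem_univ q.2)

/-- A weight of the traceless Cartan subalgebra gives only differences of row degrees. A row `b`
absent from both monomials has degree `0`, so the degrees themselves are determined. -/
theorem rowSum_eq_of_weight {k : ℕ} {ν : ℕ+ → ℕ+ → ℂ} {p p' : PolyRep k}
    (hp : ∀ i j, ⁅matUnit i i - matUnit j j, p⁆ = ν i j • p)
    (hp' : ∀ i j, ⁅matUnit i i - matUnit j j, p'⁆ = ν i j • p') {m m' : ℕ+ × Fin k →₀ ℕ}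
    (hm : m ∈ p.support) (hm' : m' ∈ p'.support) (a : ℕ+) :
    ∑ j, m (a, j) = ∑ j, m' (a, j) := by
  have key : ∀ (p : PolyRep k) (m : ℕ+ × Fin k →₀ ℕ),
      (∀ i j, ⁅matUnit i i - matUnit j j, p⁆ = ν i j • p) → m ∈ p.support → ∀ i j,
      ((∑ l, m (i, l) : ℕ) : ℂ) - ((∑ l, m (j, l) : ℕ) : ℂ) = ν i j := by
    intro p m hp hm i j
    have := congrArg (MvPolynomial.coeff m) (hp i j)
    rw [sub_lie, lie_sym_apply, lie_sym_apply, MvPolynomial.coeff_sub, coeff_symDer_diag,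
      coeff_symDer_diag, MvPolynomial.coeff_smul, ← sub_mul, smul_eq_mul] at this
    exact mul_right_cancel₀ (MvPolynomial.mem_support_iff.1 hm) this
  classical
  obtain ⟨b, hb⟩ := Infinite.exists_notMem_finset
    ((m.support ∪ m'.support).image Prod.fst)
  have hz : ∀ j, m (b, j) = 0 ∧ m' (b, j) = 0 := by
    intro j
    by_contra h
    refine hb (Finset.mem_image.2 ⟨(b, j), ?_, rfl⟩)
    rw [Finset.mem_union, Finsupp.mem_support_iff, Finsupp.mem_support_iff]
    tauto
  have h := (key p m hp hm a b).trans (key p' m' hp' hm' a b).symm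
  simp only [hz, Finset.sum_const_zero, Nat.cast_zero, sub_zero] at h
  exact_mod_cast h

theorem slFin_le_slInf (n : ℕ) : slFin n ≤ slInf := slOn_mono (Set.subset_univ _)

section Schur

variable {k : ℕ} (μ : Fin k → ℕ)

theorem hwVec_mem_schurModule : hwVec μ ∈ schurModule μ :=
  ⟨0, LieSubmodule.subset_lieSpan rfl⟩

theorem schurModule_le {T : Submodule ℂ (PolyRep k)} (h : hwVec μ ∈ T)
    (hT : ∀ x ∈ slInf, ∀ p ∈ T, ⁅x, p⁆ ∈ T) : (schurModule μ).toSubmodule ≤ T := by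
  rintro p ⟨n, hp⟩
  let T' : LieSubmodule ℂ (slFin n) (PolyRep k) :=
    { T with lie_mem := fun {x p} hp => hT x (slFin_le_slInf n x.2) p hp }
  have : schurStage μ n ≤ T' := LieSubmodule.lieSpan_le.2 (Set.singleton_subset_iff.2 h)
  exact this hp

/-- A nonzero submodule meets some stage nontrivially, so it contains that simple stage and with it
`hwVec μ`, which generates everything. -/
theorem schurModule_isIrreducible (hμ : Antitone μ) :
    LieModule.IsIrreducible ℂ slInf (schurModule μ) := by
  have hnt : Nontrivial (schurModule μ) :=
    ⟨⟨⟨hwVec μ, hwVec_mem_schurModule μ⟩, 0, fun h => hwVec_ne_zero μ (congrArg Subtype.val h)⟩⟩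
  refine LieModule.IsIrreducible.mk fun N hN => ?_
  set N' : Submodule ℂ (PolyRep k) := N.toSubmodule.map (schurModule μ).toSubmodule.subtype
    with hN'
  have hstab : ∀ x ∈ slInf, ∀ p ∈ N', ⁅x, p⁆ ∈ N' := by
    rintro x hx _ ⟨q, hq, rfl⟩
    exact ⟨_, N.lie_mem (x := (⟨x, hx⟩ : slInf)) hq, rfl⟩
  suffices hv : hwVec μ ∈ N' by
    rw [eq_top_iff]
    rintro ⟨p, hp⟩ -
    obtain ⟨q, hq, hqp⟩ := schurModule_le μ hv hstab hp
    have : q = ⟨p, hp⟩ := Subtype.ext hqp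
    exact this ▸ hq
  obtain ⟨x, hx, hx0⟩ : ∃ x ∈ N, x ≠ 0 := by
    by_contra! h0
    exact hN ((LieSubmodule.eq_bot_iff _).2 h0)
  obtain ⟨n, hn⟩ := x.2
  let P : LieSubmodule ℂ (slFin n) (schurStage μ n) :=
    { N'.comap (schurStage μ n).toSubmodule.subtype with
      lie_mem := fun {y p} hp => hstab y (slFin_le_slInf n y.2) p hp }
  have := schurStage_irreducible μ hμ n
  have hP : P = ⊤ := by
    refine (IsSimpleOrder.eq_bot_or_eq_top P).resolve_left fun h => hx0 ?_
    have hxP : (⟨x, hn⟩ : schurStage μ n) ∈ P := ⟨x, hx, rfl⟩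
    rw [h] at hxP
    exact Subtype.ext (congrArg (fun y : schurStage μ n => (y : PolyRep k)) hxP)
  exact (hP ▸ LieSubmodule.mem_top _ :
    (⟨hwVec μ, LieSubmodule.subset_lieSpan rfl⟩ : schurStage μ n) ∈ P)

theorem coe_lie_rootVec {i j : ℕ+} (hij : i ≠ j) (p : schurModule μ) :
    ((⁅rootVec i j, p⁆ : schurModule μ) : PolyRep k) = symDer k (matUnit i j) p := by
  rw [← lie_sym_apply, ← coe_rootVec hij]
  rfl

/-- For finite-dimensionality, one monomial `m₀` of one nonzero vector of weight `ν` fixes the row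
degrees of all monomials in that weight space, and only finitely many monomials have these degrees.
-/
theorem schurModule_isWeightModule (hμ : Antitone μ) :
    IsWeightModule slCartan (schurModule μ) := by
  have := schurModule_isIrreducible μ hμ
  constructor
  · refine iSup_wtSpace_eq_top (v := ⟨hwVec μ, hwVec_mem_schurModule μ⟩)
      ⟨fun a b => ((partAt μ (a - 1) : ℂ) - partAt μ (b - 1)), fun a b => Subtype.ext ?_⟩
      fun h => hwVec_ne_zero μ (congrArg Subtype.val h)
    exact (schurStage_spec μ hμ 0).2.2.2.2 a b
  · intro ν
    let ν' : ℕ+ → ℕ+ → ℂ := fun i j => ν ⟨_, cartanVec_mem i j⟩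
    have hw : ∀ p : wtSpace slCartan (schurModule μ) ν, ∀ i j,
        ⁅matUnit i i - matUnit j j, ((p : schurModule μ) : PolyRep k)⁆ =
          ν' i j • ((p : schurModule μ) : PolyRep k) := fun p i j =>
      congrArg (fun y : schurModule μ => (y : PolyRep k)) (p.2 ⟨_, cartanVec_mem i j⟩)
    by_cases h : ∃ p : wtSpace slCartan (schurModule μ) ν, p ≠ 0
    · obtain ⟨p, hp⟩ := h
      have hp' : ((p : schurModule μ) : PolyRep k) ≠ 0 := fun h =>
        hp (Subtype.ext (Subtype.ext h))
      obtain ⟨m₀, hm₀⟩ := MvPolynomial.support_nonempty.2 hp'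
      let W : Submodule ℂ (PolyRep k) := Submodule.span ℂ
        ((fun m => MvPolynomial.monomial m (1 : ℂ)) ''
          {m : ℕ+ × Fin k →₀ ℕ | ∀ a, ∑ j, m (a, j) = ∑ j, m₀ (a, j)})
      have hW : FiniteDimensional ℂ W :=
        FiniteDimensional.span_of_finite ℂ ((finite_setOf_rowSum_eq k m₀).image _)
      refine FiniteDimensional.of_injective (V₂ := W)
        (LinearMap.codRestrict W ((schurModule μ).toSubmodule.subtype ∘ₗ
          (wtSpace slCartan (schurModule μ) ν).subtype) fun q => ?_) fun a b hab => ?_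
      · change ((q : schurModule μ) : PolyRep k) ∈ W
        rw [((q : schurModule μ) : PolyRep k).as_sum]
        refine Submodule.sum_mem _ fun m hm => ?_
        rw [← mul_one (MvPolynomial.coeff _ _), ← smul_eq_mul, ← MvPolynomial.smul_monomial]
        exact Submodule.smul_mem _ _ (Submodule.subset_span
          ⟨m, fun a => rowSum_eq_of_weight (hw q) (hw p) hm hm₀ a, rfl⟩)
      · exact Subtype.ext (Subtype.ext (congrArg (fun x : W => (x : PolyRep k)) hab))
    · push Not at h
      have : Subsingleton (wtSpace slCartan (schurModule μ) ν) :=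
        ⟨fun a b => (h a).trans (h b).symm⟩
      infer_instance

end Schur

/-! ## Minors, and the rows that occur in elements of `S^μ V` -/

/-- The minor of the first `m` columns with rows `f 0, …, f (m-1)`. -/
noncomputable def rowMinor (k : ℕ) {m : ℕ} (hm : m ≤ k) (f : Fin m → ℕ+) : PolyRep k :=
  Matrix.det (Matrix.of fun a j : Fin m =>
    (MvPolynomial.X (f a, Fin.castLE hm j) : PolyRep k))

theorem rowMinor_eq_zero {k m : ℕ} (hm : m ≤ k) {f : Fin m → ℕ+} {s t : Fin m} (hst : s ≠ t)
    (h : f s = f t) : rowMinor k hm f = 0 :=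
  Matrix.det_zero_of_row_eq hst (funext fun j => by simp [h])

theorem symDer_rowMinor {k m : ℕ} (hm : m ≤ k) (f : Fin m → ℕ+) (a b : ℕ+) :
    symDer k (matUnit a b) (rowMinor k hm f) =
      ∑ s, if f s = b then rowMinor k hm (Function.update f s a) else 0 := by
  rw [rowMinor, derivation_det]
  refine Finset.sum_congr rfl fun s _ => ?_
  simp only [Matrix.of_apply, symDer_X, matUnit_single]
  split_ifs with h
  · rw [rowMinor]
    congr 1
    ext1 p q
    by_cases hp : p = s
    · subst hp; simp [colEmb]
    · rw [Matrix.updateRow_ne hp]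
      simp [Function.update_of_ne hp]
  · refine Matrix.det_eq_zero_of_row_eq_zero s fun q => ?_
    simp

section Rows

variable {k : ℕ}

/-- The ideal generated by the maximal minors. -/
noncomputable def minorIdeal (k : ℕ) : Ideal (PolyRep k) :=
  Ideal.span (Set.range (rowMinor k le_rfl))

theorem symDer_mem_minorIdeal {a b : ℕ+} {p : PolyRep k} (hp : p ∈ minorIdeal k) :
    symDer k (matUnit a b) p ∈ minorIdeal k := by
  refine Submodule.span_induction (p := fun p _ => symDer k (matUnit a b) p ∈ minorIdeal k)
    ?_ (by simp) (fun x y _ _ hx hy => by rw [map_add]; exact Ideal.add_mem _ hx hy)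
    (fun c x hx ih => ?_) hp
  · rintro _ ⟨f, rfl⟩
    rw [symDer_rowMinor]
    refine Ideal.sum_mem _ fun s _ => ?_
    split_ifs
    · exact Ideal.subset_span ⟨_, rfl⟩
    · exact Ideal.zero_mem _
  · rw [smul_eq_mul, Derivation.leibniz, smul_eq_mul, smul_eq_mul]
    exact Ideal.add_mem _ (Ideal.mul_mem_left _ _ ih) (Ideal.mul_mem_right _ _ hx)

/-- The ideal is stable under the action, since `E_{ab}` sends minors to sums of minors; thus only
the generator `hwVec μ` needs checking. -/
theorem schurModule_le_minorIdeal (hk : 0 < k) {μ : Fin k → ℕ} (hμpos : ∀ j, 0 < μ j)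
    {p : PolyRep k} (hp : p ∈ schurModule μ) : p ∈ minorIdeal k := by
  refine schurModule_le μ (T := (minorIdeal k).restrictScalars ℂ) ?_ ?_ hp
  · let l : Fin k := ⟨k - 1, Nat.sub_lt hk Nat.one_pos⟩
    have hl : (l : ℕ) + 1 = k := Nat.sub_add_cancel hk
    have hmem : ∀ (m : ℕ) (hm : m ≤ k), m = k → leadMinor k m hm ∈ minorIdeal k := by
      rintro m hm rfl
      exact Ideal.subset_span ⟨fun a => (a : ℕ).succPNat, rfl⟩
    -- The factor with index `l` is the full leading minor to the power `μ_k - 0`, which is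
    -- positive.
    refine Ideal.mem_of_dvd _ (Finset.dvd_prod_of_mem _ (Finset.mem_univ l)) ?_
    refine Ideal.pow_mem_of_mem _ (hmem _ _ hl) _ ?_
    have : partAt μ (l + 1) = 0 := by simp [partAt, hl]
    rw [this]
    exact hμpos l
  · intro x hx p hp
    change ((⟨x, hx⟩ : slInf) : Module.End ℂ NatRep) ∈ slInf at hx
    have key : ∀ x : slInf, symDer k x p ∈ minorIdeal k := by
      intro x
      induction x using slInf_induction with
      | zero =>
        change symAct k 0 p ∈ _
        rw [map_zero]
        exact Ideal.zero_mem _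
      | add x y hx hy =>
        change symAct k (x + y) p ∈ _
        rw [map_add]
        exact Ideal.add_mem _ hx hy
      | smul c x hx =>
        change symAct k (c • (x : Module.End ℂ NatRep)) p ∈ _
        rw [map_smul]
        exact Submodule.smul_of_tower_mem (minorIdeal k) c hx
      | root i j hij =>
        rw [coe_rootVec hij]
        exact symDer_mem_minorIdeal hp
      | cartan i j =>
        change symAct k (matUnit i i - matUnit j j) p ∈ _
        rw [map_sub]
        exact Ideal.sub_mem _ (symDer_mem_minorIdeal hp) (symDer_mem_minorIdeal hp)
    exact key ⟨x, hx⟩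

/-- Setting all variables in rows outside `F` to zero fixes `p`. If `F` had fewer than `k` elements,
every maximal minor would have a repeated row or a row outside `F`, so the substitution would kill
the whole ideal and `p` with it. -/
theorem le_card_of_mem_minorIdeal {p : PolyRep k} (hp : p ∈ minorIdeal k) (hp0 : p ≠ 0)
    {F : Finset ℕ+} (hF : ∀ q ∈ p.vars, q.1 ∈ F) : k ≤ F.card := by
  classical
  by_contra! hlt
  let e : PolyRep k →+* PolyRep k := (MvPolynomial.aeval (R := ℂ) fun q : ℕ+ × Fin k =>
    if q.1 ∈ F then (MvPolynomial.X q : PolyRep k) else 0).toRingHom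
  have heX : ∀ q : ℕ+ × Fin k, e (MvPolynomial.X q) =
      if q.1 ∈ F then (MvPolynomial.X q : PolyRep k) else 0 := fun q => by simp [e]
  have h1 : e p = p := by
    refine MvPolynomial.hom_congr_vars (f₁ := e) (f₂ := RingHom.id _) ?_ (fun q hq _ => ?_) rfl
    · ext c; simp [e]
    · rw [heX, if_pos (hF q hq), RingHom.id_apply]
  have h2 : minorIdeal k ≤ RingHom.ker e := by
    refine Ideal.span_le.2 ?_
    rintro _ ⟨f, rfl⟩
    change e _ = 0
    by_cases hf : ∀ s, f s ∈ F
    · have hninj : ¬ Function.Injective f := by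
        intro hinj
        have := Finset.card_le_card_of_injOn f (s := Finset.univ) (t := F) (fun s _ => hf s)
          hinj.injOn
        rw [Finset.card_univ, Fintype.card_fin] at this
        omega
      obtain ⟨s, t, h, hne⟩ : ∃ s t, f s = f t ∧ s ≠ t := by
        simpa [Function.Injective] using hninj
      rw [rowMinor_eq_zero le_rfl hne h, map_zero]
    · push Not at hf
      obtain ⟨s, hs⟩ := hf
      rw [rowMinor, RingHom.map_det]
      refine Matrix.det_eq_zero_of_row_eq_zero s fun q => ?_
      simp [heX, hs]
  exact hp0 (h1.symm.trans (h2 hp))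

/-- If `E_{ij}` kills a polynomial in which row `j` occurs, then row `i` occurs as well. -/
theorem exists_mem_vars_of_symDer_eq_zero {p : PolyRep k} {i j : ℕ+}
    (h : symDer k (matUnit i j) p = 0) {l : Fin k} (hj : (j, l) ∈ p.vars) :
    ∃ l', (i, l') ∈ p.vars := by
  by_contra! hi
  obtain ⟨m, hm, hml⟩ := (MvPolynomial.mem_vars_iff_mem_support _).1 hj
  have hmi : ∀ l', m (i, l') = 0 := by
    intro l'
    by_contra h0
    exact hi l' ((MvPolynomial.mem_vars_iff_mem_support _).2 ⟨m, hm, Finsupp.mem_support_iff.2 h0⟩)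
  have hle : Finsupp.single (j, l) 1 ≤ m :=
    Finsupp.single_le_iff.2 (Nat.one_le_iff_ne_zero.2 (Finsupp.mem_support_iff.1 hml))
  -- This is the monomial `m` with one factor `x_{j,l}` changed to `x_{i,l}`. As row `i` does not
  -- occur in `m`, only the summand for column `l` contributes, with the nonzero coefficient of `m`
  -- times its exponent at `(j, l)`.
  have hc := congrArg (MvPolynomial.coeff
    (Finsupp.single (i, l) 1 + (m - Finsupp.single (j, l) 1))) h
  rw [symDer_matUnit, MvPolynomial.coeff_sum, Finset.sum_eq_single l, MvPolynomial.coeff_X_mul,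
    MvPolynomial.coeff_pderiv, tsub_add_cancel_of_le hle, MvPolynomial.coeff_zero] at hc
  · refine (mul_ne_zero (MvPolynomial.mem_support_iff.1 hm) ?_) hc
    exact Nat.cast_add_one_ne_zero _
  · intro l' _ hl'
    rw [MvPolynomial.coeff_X_mul', if_neg]
    rw [Finsupp.mem_support_iff, not_not]
    have h1 : (i, l) ≠ (i, l') := fun h => hl' (Prod.ext_iff.1 h).2.symm
    simp [hmi, h1]
  · simp

end Rows

/-! ## Highest weight vectors in other rows -/

section RowVectors

variable {k : ℕ}

/-- The analogue of the highest weight vector with the rows `f 0, …, f (k-1)`. -/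
noncomputable def rowVec (μ : Fin k → ℕ) (f : Fin k → ℕ+) : PolyRep k :=
  ∏ j : Fin k, rowMinor k j.isLt (fun a => f (Fin.castLE j.isLt a)) ^
    (μ j - partAt μ (j + 1))

theorem rowVec_ne_zero (μ : Fin k → ℕ) {f : Fin k → ℕ+} (hf : Function.Injective f) :
    rowVec μ f ≠ 0 := by
  refine Finset.prod_ne_zero_iff.2 fun j _ => pow_ne_zero _ fun h0 => ?_
  -- At the point where `x_{f l, l} = 1` and all other variables vanish, injectivity of `f` turns
  -- the matrix of the minor into the identity.
  have := congrArg (MvPolynomial.eval fun q : ℕ+ × Fin k =>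
    if q.1 = f q.2 then (1 : ℂ) else 0) h0
  rw [rowMinor, RingHom.map_det, map_zero] at this
  have h1 : (MvPolynomial.eval fun q : ℕ+ × Fin k =>
      if q.1 = f q.2 then (1 : ℂ) else 0).mapMatrix (Matrix.of fun a l : Fin (j + 1) =>
    (MvPolynomial.X (f (Fin.castLE j.isLt a), Fin.castLE j.isLt l) : PolyRep k)) = 1 := by
    ext a l
    simp [Matrix.one_apply, hf.eq_iff]
  rw [h1, Matrix.det_one] at this
  exact one_ne_zero this

theorem symDer_diag_rowVec (μ : Fin k → ℕ) (f : Fin k → ℕ+) (a : ℕ+) :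
    ∃ c : ℂ, symDer k (matUnit a a) (rowVec μ f) = c • rowVec μ f := by
  refine ⟨_, derivation_prod_pow (symDer k (matUnit a a)) Finset.univ
    (fun j : Fin k => rowMinor k j.isLt fun s => f (Fin.castLE j.isLt s))
    (fun j => ∑ s : Fin (j + 1), if f (Fin.castLE j.isLt s) = a then 1 else 0) _ fun j => ?_⟩
  rw [symDer_rowMinor, Finset.sum_smul]
  refine Finset.sum_congr rfl fun s _ => ?_
  split_ifs with h
  · rw [one_smul, ← h, Function.update_eq_self_iff.2 rfl]
  · rw [zero_smul]

/-- The minors use initial segments of `f`, so each one containing row `b` also contains the earlier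
row `a`. Replacing `b` by `a` duplicates a row. -/
theorem symDer_rowVec_eq_zero (μ : Fin k → ℕ) {f : Fin k → ℕ+} {a b : ℕ+}
    (h : ∀ s, f s = b → ∃ t < s, f t = a) : symDer k (matUnit a b) (rowVec μ f) = 0 := by
  have := derivation_prod_pow (symDer k (matUnit a b)) Finset.univ
    (fun j : Fin k => rowMinor k j.isLt fun s => f (Fin.castLE j.isLt s))
    (fun _ => 0) (fun j => μ j - partAt μ (j + 1)) fun j => ?_
  · rw [rowVec, this]
    simp
  · rw [symDer_rowMinor, zero_smul]
    refine Finset.sum_eq_zero fun s _ => ?_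
    split_ifs with hs
    · obtain ⟨t, ht, hta⟩ := h _ hs
      have ht' : (t : ℕ) < s := ht
      have hne : (⟨t, ht'.trans s.isLt⟩ : Fin (j + 1)) ≠ s := fun h => by
        rw [← h] at ht'
        exact lt_irrefl _ ht'
      refine rowMinor_eq_zero _ hne ?_
      rw [Function.update_of_ne hne, Function.update_self]
      exact hta
    · rfl

/-- Since `D` applied twice kills `p`, only two terms of the iterated Leibniz rule survive. -/
theorem derivation_iterate_mul {A : Type*} [CommRing A] [Algebra ℂ A] (D : Derivation ℂ A A)
    {p p' : A} (h : D p = p') (h' : D p' = 0) (q : A) (n : ℕ) :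
    D^[n + 1] (p * q) = p * D^[n + 1] q + (n + 1 : ℕ) • (p' * D^[n] q) := by
  induction n with
  | zero => simp [h, mul_comm]
  | succ n ih =>
    rw [Function.iterate_succ_apply', ih, map_add, map_nsmul, Derivation.leibniz,
      Derivation.leibniz, h, h', smul_zero, add_zero, ← Function.iterate_succ_apply' D (n + 1) q,
      ← Function.iterate_succ_apply' D n q, smul_eq_mul, smul_eq_mul, smul_eq_mul,
      succ_nsmul (p' * _) (n + 1)]
    ring

/-- The invariant is that `D^d` sends the product to `d!` times its primed version, which `D` kills.
A factor with `D p = p'` raises `d` by one and supplies the factor `d + 1`; a factor killed by `D`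
passes through unchanged. -/
theorem exists_iterate_pow_mul {A : Type*} [CommRing A] [Algebra ℂ A] (D : Derivation ℂ A A)
    {p p' q q' : A} (h : D p = p' ∨ (D p = 0 ∧ p' = p)) (h' : D p' = 0)
    (hq : ∃ d : ℕ, D^[d] q = d.factorial • q' ∧ D q' = 0) (e : ℕ) :
    ∃ d : ℕ, D^[d] (p ^ e * q) = d.factorial • (p' ^ e * q') ∧ D (p' ^ e * q') = 0 := by
  induction e with
  | zero => simpa using hq
  | succ e ih =>
    obtain ⟨d, hd, hd'⟩ := ih
    have h2 : D (p' ^ (e + 1) * q') = 0 := by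
      rw [pow_succ', mul_assoc, Derivation.leibniz, hd', h', smul_zero, smul_zero, add_zero]
    rcases h with h | ⟨h, rfl⟩
    · refine ⟨d + 1, ?_, h2⟩
      rw [pow_succ', mul_assoc, derivation_iterate_mul D h h', Function.iterate_succ_apply', hd,
        map_nsmul, hd', smul_zero, mul_zero, zero_add, Nat.factorial_succ, mul_smul_comm,
        smul_smul, pow_succ', mul_assoc]
    · refine ⟨d, ?_, h2⟩
      have hc : ∀ (n : ℕ) (x : A), D^[n] (p' * x) = p' * D^[n] x := by
        intro n x
        induction n with
        | zero => rfl
        | succ n ih =>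
          rw [Function.iterate_succ_apply', ih, Derivation.leibniz, h, smul_zero, add_zero,
            smul_eq_mul, Function.iterate_succ_apply']
      rw [pow_succ', mul_assoc, hc, hd, mul_smul_comm, mul_assoc]

theorem exists_iterate_prod_pow {A ι : Type*} [CommRing A] [Algebra ℂ A] (D : Derivation ℂ A A)
    (s : Finset ι) {p p' : ι → A} (h : ∀ i, D (p i) = p' i ∨ (D (p i) = 0 ∧ p' i = p i))
    (h' : ∀ i, D (p' i) = 0) (e : ι → ℕ) :
    ∃ d : ℕ, D^[d] (∏ i ∈ s, p i ^ e i) = d.factorial • (∏ i ∈ s, p' i ^ e i) ∧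
      D (∏ i ∈ s, p' i ^ e i) = 0 := by
  classical
  induction s using Finset.induction_on with
  | empty => exact ⟨0, by simp⟩
  | insert i s hi ih =>
    rw [Finset.prod_insert hi, Finset.prod_insert hi]
    exact exists_iterate_pow_mul D (h i) (h' i) ih (e i)

/-- The root vector `E_{b, f s}` replaces row `f s` by `b` in every minor containing it and kills
the other minors. A suitable power of it sends `rowVec μ f` to a nonzero factorial multiple of the
updated vector. -/
theorem rowVec_update_mem_schurModule {μ : Fin k → ℕ} {f : Fin k → ℕ+}
    (hf : Function.Injective f) (h : rowVec μ f ∈ schurModule μ) (s : Fin k) (b : ℕ+)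
    (hb : f s ≠ b) : rowVec μ (Function.update f s b) ∈ schurModule μ := by
  obtain ⟨d, hd, -⟩ := exists_iterate_prod_pow (symDer k (matUnit b (f s))) Finset.univ
    (p := fun j : Fin k => rowMinor k j.isLt fun t => f (Fin.castLE j.isLt t))
    (p' := fun j : Fin k => rowMinor k j.isLt fun t =>
      Function.update f s b (Fin.castLE j.isLt t))
    (fun j => by
      rw [symDer_rowMinor]
      by_cases hs : (s : ℕ) < j + 1
      · left
        rw [Finset.sum_eq_single ⟨s, hs⟩]
        · refine (if_pos rfl).trans ?_
          congr 1
          funext t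
          by_cases ht : t = ⟨s, hs⟩
          · subst ht
            rw [Function.update_self]
            exact (Function.update_self (f := f) s b).symm
          · rw [Function.update_of_ne ht, Function.update_of_ne]
            rintro rfl
            exact ht rfl
        · intro t _ ht
          rw [if_neg]
          intro h
          have := hf h
          exact ht (Fin.ext (congrArg (fun x : Fin k => (x : ℕ)) this))
        · simp
      · right
        constructor
        · refine Finset.sum_eq_zero fun t _ => if_neg fun h => hs ?_
          rw [← hf h]
          exact t.isLt
        · congr 1
          funext t
          rw [Function.update_of_ne]
          rintro rfl
          exact hs t.isLt)
    (fun j => by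
      rw [symDer_rowMinor]
      refine Finset.sum_eq_zero fun t _ => if_neg fun h => ?_
      by_cases ht : Fin.castLE j.isLt t = s
      · rw [ht, Function.update_self] at h
        exact hb h.symm
      · rw [Function.update_of_ne ht] at h
        exact ht (hf h))
    (fun j => μ j - partAt μ (j + 1))
  have hiter : ∀ n, (symDer k (matUnit b (f s)))^[n] (rowVec μ f) ∈ schurModule μ := by
    intro n
    induction n with
    | zero => exact h
    | succ n ih =>
      rw [Function.iterate_succ_apply']
      have := (⁅rootVec b (f s), (⟨_, ih⟩ : schurModule μ)⁆ : schurModule μ).2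
      rwa [coe_lie_rootVec μ hb.symm] at this
  have h1 := hiter d
  rw [rowVec, hd] at h1
  rw [← Nat.cast_smul_eq_nsmul ℂ] at h1
  exact (Submodule.smul_mem_iff (schurModule μ).toSubmodule
    (Nat.cast_ne_zero.2 (Nat.factorial_ne_zero d))).1 h1

/-- The rows are exchanged one at a time through `c t`, which takes its first `t` rows from `g` and
the others from `f`. Disjointness of the ranges keeps every `c t` injective. -/
theorem rowVec_mem_schurModule_of_disjoint {μ : Fin k → ℕ} {f g : Fin k → ℕ+}
    (hf : Function.Injective f) (hg : Function.Injective g) (hfg : ∀ a b, f a ≠ g b)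
    (h : rowVec μ f ∈ schurModule μ) : rowVec μ g ∈ schurModule μ := by
  let c : ℕ → Fin k → ℕ+ := fun t a => if (a : ℕ) < t then g a else f a
  have hc : ∀ t, Function.Injective (c t) := by
    intro t a b hab
    simp only [c] at hab
    split_ifs at hab
    · exact hg hab
    · exact (hfg _ _ hab.symm).elim
    · exact (hfg _ _ hab).elim
    · exact hf hab
  have key : ∀ t ≤ k, rowVec μ (c t) ∈ schurModule μ := by
    intro t
    induction t with
    | zero => intro _; simpa [c] using h
    | succ t ih =>
      intro ht
      have hct : c (t + 1) = Function.update (c t) ⟨t, ht⟩ (g ⟨t, ht⟩) := by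
        funext a
        by_cases ha : a = ⟨t, ht⟩
        · subst ha; simp [c]
        · rw [Function.update_of_ne ha]
          have : (a : ℕ) ≠ t := fun h => ha (Fin.ext h)
          have : (a : ℕ) < t + 1 ↔ (a : ℕ) < t := by omega
          simp only [c, this]
      rw [hct]
      refine rowVec_update_mem_schurModule (hc t) (ih (by omega)) _ _ ?_
      simpa [c] using hfg _ _
  have hck : c k = g := by
    funext a
    simp [c]
  exact hck ▸ key k le_rfl

theorem rowVec_mem_schurModule (μ : Fin k → ℕ) {f : Fin k → ℕ+} (hf : Function.Injective f) :
    rowVec μ f ∈ schurModule μ := by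
  -- The rows `f` may overlap `1, …, k`, so the exchange goes through the rows `B + 1, …, B + k`,
  -- which avoid both.
  let B : ℕ := k + ∑ a, (f a : ℕ)
  have hB : ∀ a, (f a : ℕ) ≤ B := fun a =>
    (Finset.single_le_sum (f := fun a => (f a : ℕ)) (fun _ _ => Nat.zero_le _)
      (Finset.mem_univ a)).trans (Nat.le_add_left _ _)
  let g : Fin k → ℕ+ := fun a => (B + a : ℕ).succPNat
  have hg : Function.Injective g := fun a b h => by
    have := Nat.succPNat_injective h
    exact Fin.ext (by omega)
  refine rowVec_mem_schurModule_of_disjoint hg hf (fun a b h => ?_)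
    (rowVec_mem_schurModule_of_disjoint (f := fun a => (a : ℕ).succPNat)
      (fun a b h => Fin.ext (Nat.succPNat_injective h)) hg (fun a b h => ?_)
      -- By definition, `hwVec μ` is `rowVec μ` for the rows `1, …, k`.
      (hwVec_mem_schurModule μ))
  · have h1 := congrArg PNat.val h
    have h2 := hB b
    change B + a + 1 = (f b : ℕ) at h1
    omega
  · have h1 := Nat.succPNat_injective h
    have := a.isLt
    omega

end RowVectors

/-! ## Initial segments of the order -/

/-- A set that is closed under passing to smaller elements, has at least `k` elements and is ranked
has a closed subset with `k` elements. -/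
theorem exists_enumeration {r : ℕ+ → ℕ+ → Prop} {P : Set ℕ+} (hP : ∀ i j, r i j → j ∈ P → i ∈ P)
    {ρ : ℕ+ → ℕ} (hρ : ∀ i ∈ P, ∀ j ∈ P, r i j → ρ i < ρ j) {k : ℕ} {F : Finset ℕ+}
    (hF : ↑F ⊆ P) (hFk : k ≤ F.card) :
    ∃ f : Fin k → ℕ+, Function.Injective f ∧ (∀ a, f a ∈ P) ∧
      ∀ i b, r i (f b) → ∃ a < b, f a = i := by
  classical
  induction k with
  | zero => exact ⟨Fin.elim0, fun a => a.elim0, fun a => a.elim0, fun _ b => b.elim0⟩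
  | succ k ih =>
    obtain ⟨f, hf, hfP, hlow⟩ := ih (by omega)
    -- The next entry is an unused element of minimal rank. Its predecessors lie in `P` and have
    -- smaller rank, so they have already been listed.
    have hne : ∃ n x, x ∈ P ∧ (∀ a, f a ≠ x) ∧ ρ x = n := by
      by_contra! h
      have hsub : F ⊆ Finset.univ.image f := by
        intro x hx
        by_contra hx'
        refine h (ρ x) x (hF hx) (fun a ha => hx' ?_) rfl
        exact Finset.mem_image.2 ⟨a, Finset.mem_univ a, ha⟩
      have := (Finset.card_le_card hsub).trans Finset.card_image_le
      rw [Finset.card_univ, Fintype.card_fin] at this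
      omega
    obtain ⟨x, hxP, hx, hρx⟩ := Nat.find_spec hne
    have hmin : ∀ y ∈ P, ρ y < ρ x → ∃ a, f a = y := by
      intro y hy hyx
      by_contra! h
      exact Nat.find_min hne (hρx ▸ hyx) ⟨y, hy, h, rfl⟩
    refine ⟨Fin.snoc (α := fun _ => ℕ+) f x, ?_, ?_, ?_⟩
    · rw [Fin.snoc_injective_iff]
      exact ⟨hf, fun ⟨a, ha⟩ => hx a ha⟩
    · intro a
      refine Fin.lastCases ?_ (fun a => ?_) a
      · simpa using hxP
      · simpa using hfP a
    · intro i b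
      refine Fin.lastCases ?_ (fun b => ?_) b
      · intro h
        rw [Fin.snoc_last] at h
        have hi := hP i x h hxP
        obtain ⟨a, ha⟩ := hmin i hi (hρ i hi x hxP h)
        exact ⟨a.castSucc, Fin.castSucc_lt_last a, by simpa using ha⟩
      · intro h
        rw [Fin.snoc_castSucc] at h
        obtain ⟨a, hab, ha⟩ := hlow i b h
        exact ⟨a.castSucc, Fin.castSucc_lt_castSucc_iff.2 hab, by simpa using ha⟩

open Classical in
theorem card_filter_lt_card_filter {r : ℕ+ → ℕ+ → Prop} {F : Finset ℕ+} {i j c : ℕ+}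
    (hc : c ∈ F) (hcj : r c j) (hci : ¬ r c i) (h : ∀ a ∈ F, r a i → r a j) :
    (F.filter fun a => r a i).card < (F.filter fun a => r a j).card := by
  refine Finset.card_lt_card (Finset.ssubset_iff_of_subset ?_ |>.2 ⟨c, ?_, ?_⟩)
  · intro a ha
    rw [Finset.mem_filter] at ha ⊢
    exact ⟨ha.1, h a ha.1 ha.2⟩
  · exact Finset.mem_filter.2 ⟨hc, hcj⟩
  · exact fun h => hci (Finset.mem_filter.1 h).2

/-- The rows described in the theorem can be chosen to form an initial segment. -/
theorem exists_initial_segment {r : ℕ+ → ℕ+ → Prop} [IsStrictOrder ℕ+ r] (hadm : IsAdmissible r)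
    {k : ℕ} (hk : 0 < k) {i : Fin k → ℕ+} (hinj : Function.Injective i)
    (hord : ∀ a b, r (i a) (i b) → a < b)
    (hall : ∀ m : ℕ+, m ∉ Set.range i →
      r (i ⟨k - 1, Nat.sub_lt hk Nat.one_pos⟩) m ∨ ∃ j, Incomp r m (i j)) :
    ∃ f : Fin k → ℕ+, Function.Injective f ∧ ∀ c b, r c (f b) → ∃ a < b, f a = c := by
  classical
  set l : Fin k := ⟨k - 1, Nat.sub_lt hk Nat.one_pos⟩ with hl
  have hle : ∀ a : Fin k, a ≤ l := fun a => by
    have := a.isLt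
    exact Fin.mk_le_mk.2 (by omega : (a : ℕ) ≤ k - 1)
  -- `P` is the union of the classes of the given indices. An element outside `P` lies above the
  -- last index, so it cannot precede an element of `P` without contradicting the ordering of the
  -- indices.
  let P : Set ℕ+ := {m | ∃ j, Incomp r m (i j)}
  have hiP : ∀ a, i a ∈ P := fun a => ⟨a, incomp_self r _⟩
  have hP : ∀ c m, r c m → m ∈ P → c ∈ P := by
    rintro c m hcm ⟨j, hj⟩
    by_contra hc
    have hc' : c ∉ Set.range i := fun ⟨a, ha⟩ => hc (ha ▸ hiP a)
    have hlc := (hall c hc').resolve_right hc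
    exact not_lt_of_ge (hle j) (hord l j (_root_.trans hlc (hadm.lt_of_lt_of_incomp hcm hj)))
  obtain ⟨f, hf, -, hlow⟩ := exists_enumeration (r := r) (P := P) hP
    -- `P` may be infinite, so the rank counts only the given indices below `m`. If `a ≺ b` and `a`
    -- is incomparable with `i j`, admissibility puts `i j` below `b` but not below `a`, so the rank
    -- increases.
    (ρ := fun m => ((Finset.univ.image i).filter fun a => r a m).card) (by
      rintro a ⟨j, hj⟩ b _ hab
      exact card_filter_lt_card_filter (c := i j)
        (Finset.mem_image.2 ⟨j, Finset.mem_univ j, rfl⟩)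
        (hadm.lt_of_incomp_of_lt hj.symm hab) hj.2 fun c _ hc => _root_.trans hc hab)
    (k := k) (F := Finset.univ.image i) (by
      intro x hx
      obtain ⟨a, -, rfl⟩ := Finset.mem_image.1 (Finset.mem_coe.1 hx)
      exact hiP a) (by
      rw [Finset.card_image_of_injective _ hinj, Finset.card_univ, Fintype.card_fin])
  exact ⟨f, hf, hlow⟩

/-- In the enumeration every predecessor of an entry is itself an earlier entry. An index that is
not listed therefore precedes no entry; in particular it lies above the last entry or is
incomparable with it. -/
theorem exists_rows_of_initial_segment {r : ℕ+ → ℕ+ → Prop} [IsStrictOrder ℕ+ r]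
    {k : ℕ} (hk : 0 < k) {F : Finset ℕ+} (hF : ∀ i j, r i j → j ∈ F → i ∈ F)
    (hFk : k ≤ F.card) :
    ∃ i : Fin k → ℕ+, Function.Injective i ∧ (∀ a b, r (i a) (i b) → a < b) ∧
      ∀ m : ℕ+, m ∉ Set.range i →
        r (i ⟨k - 1, Nat.sub_lt hk Nat.one_pos⟩) m ∨ ∃ j, Incomp r m (i j) := by
  classical
  obtain ⟨f, hf, -, hlow⟩ := exists_enumeration (r := r) (P := ↑F) hF
    (ρ := fun m => (F.filter fun a => r a m).card) (fun a ha b _ hab =>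
      card_filter_lt_card_filter (c := a) ha hab (irrefl a) fun c _ hc => _root_.trans hc hab)
    (F := F) subset_rfl hFk
  refine ⟨f, hf, fun a b h => ?_, fun m hm => ?_⟩
  · obtain ⟨c, hc, hca⟩ := hlow _ _ h
    exact hf hca ▸ hc
  · by_contra! h
    refine h.2 ⟨k - 1, Nat.sub_lt hk Nat.one_pos⟩ ⟨fun h' => hm ?_, h.1⟩
    obtain ⟨a, -, ha⟩ := hlow _ _ h'
    exact ⟨a, ha⟩

/-! ### The equivalence -/

/-- `S^μ V` is `𝔭(≺)`-aligned if and only if there are `i_1, …, i_k` as described. -/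
theorem mainTheorem5 (k : ℕ) (hk : 0 < k) (μ : Fin k → ℕ) (hμpos : ∀ j, 0 < μ j)
    (hμ : Antitone μ) (r : ℕ+ → ℕ+ → Prop) (hr : IsStrictOrder ℕ+ r) (hadm : IsAdmissible r) :
    IsAligned slCartan (parabolic r) (levi r) (nilrad r) (schurModule μ) ↔
      ∃ i : Fin k → ℕ+, Function.Injective i ∧ (∀ a b, r (i a) (i b) → a < b) ∧
        ∀ m : ℕ+, m ∉ Set.range i →
          r (i ⟨k - 1, Nat.sub_lt hk Nat.one_pos⟩) m ∨ ∃ j, Incomp r m (i j) := by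
  classical
  constructor
  · intro h
    -- The vector `v` need not be a weight vector: only the set of rows occurring in it matters
    -- below.
    obtain ⟨v, hv0, hv⟩ := h.exists_ne_zero (nilrad_le_parabolic r)
    have hp0 : (v : PolyRep k) ≠ 0 := fun h => hv0 (Subtype.ext h)
    refine exists_rows_of_initial_segment hk (F := (v : PolyRep k).vars.image Prod.fst) ?_
      (le_card_of_mem_minorIdeal (schurModule_le_minorIdeal hk hμpos v.2) hp0
        fun q hq => Finset.mem_image_of_mem _ hq)
    intro i j hij hj
    obtain ⟨⟨j, l⟩, hjl, rfl⟩ := Finset.mem_image.1 hj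
    have hne : i ≠ j := ne_of_irrefl hij
    have h0 := congrArg (fun x : schurModule μ => (x : PolyRep k))
      (hv _ (rootVec_mem_nilrad hij))
    obtain ⟨l', hl'⟩ := exists_mem_vars_of_symDer_eq_zero
      ((coe_lie_rootVec μ hne v).symm.trans h0) hjl
    exact Finset.mem_image.2 ⟨_, hl', rfl⟩
  · rintro ⟨i, hinj, hord, hall⟩
    obtain ⟨f, hf, hlow⟩ := exists_initial_segment hadm hk hinj hord hall
    have := schurModule_isIrreducible μ hμ
    -- The eigenvalues `c a` of `E_{aa}` give the weight `c a - c b` of `rowVec μ f` on `cartanVec a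
    -- b`.
    choose c hc using symDer_diag_rowVec μ f
    refine isAligned_of_weightVector (v := ⟨rowVec μ f, rowVec_mem_schurModule μ hf⟩) hadm
      ⟨fun a b => c a - c b, fun a b => Subtype.ext ?_⟩ (fun a b hab => Subtype.ext ?_)
      (schurModule_isWeightModule μ hμ) fun h => rowVec_ne_zero μ hf (congrArg Subtype.val h)
    · change ⁅matUnit a a - matUnit b b, rowVec μ f⁆ = (c a - c b) • rowVec μ f
      rw [sub_lie, lie_sym_apply, lie_sym_apply, hc, hc, sub_smul]
    · rw [coe_lie_rootVec μ (ne_of_irrefl hab)]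
      exact symDer_rowVec_eq_zero μ fun s hs => hlow a s (hs ▸ hab)
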